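/- Let $\mathbb{P}_n(K)$ denote the space of real polynomials in three variables of total degree at most $n$, restricted to $K\subset\mathbb{R}^3$; for $K=S^2$ one has $\dim \mathbb{P}_{2n}(S^2)=(2n+1)^2$ for all $n\ge 0$. For a finite set $A\subset S^2$ and $\nu\ge 0$, a *Caratheodory–Tchakaloff (CATCH) set of degree $\nu$ extracted from $A$* is a set $T\subseteq A$ with at most $\dim\mathbb{P}_\nu(A)$ points, together with weights $w_t>0$, $t\in T$, such that $\sum_{x\in A}p(x)=\sum_{t\in T}w_t\,p(t)$ for all $p\in\mathbb{P}_\nu(S^2)$. A *weighted least squares polynomial* $\mathcal{L}^w_Tf$ of degree $n$ for $f\in C(S^2)$ is a minimizer of $\sum_{t\in T}w_t\,(f(t)-p(t))^2$ over $p\in\mathbb{P}_n(S^2)$. Finite sets $T_n\subset S^2$, $n\ge1$, form a *weakly admissible mesh with constants $C_n$* if $\|p\|_{L^\infty(S^2)}\le C_n\max_{T_n}|p|$ for all $n\ge1$ and $p\in\mathbb{P}_n(S^2)$, $\mathrm{card}(T_n)=\mathcal{O}((\dim\mathbb{P}_n(S^2))^\beta)$ for some $\beta\ge1$, and $C_n=\mathcal{O}(n^s)$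 for some $s\ge0$. (a) Let $\alpha>0$ and let $X_M\subset S^2$, $M\ge2$, be sets of $M$ points forming a good covering, i.e. $\max_{x\in S^2}\min_{y\in X_M}|x-y|\le\alpha/\sqrt{M}$. Let $\theta\in(0,1)$ and, for $n\ge1$, $$\sigma_n=\frac{2\pi\alpha}{\theta\,(2\pi-\theta/n)},\qquad M_n=\lceil\sigma_n^2n^2\rceil,\qquad \mathcal{A}_n=X_{M_n}.$$ Then for every $n\ge1$ a CATCH set $T_{2n}$ of degree $2n$ can be extracted from $\mathcal{A}_n$. For every such choice of the $T_{2n}$ with weights $w$, the sequence $(T_{2n})_{n\ge1}$ is a weakly admissible mesh of $S^2$ (in degree $n$) with constants $$C_n=\frac{\sigma_n n}{1-\theta}\sim\frac{\alpha n}{\theta(1-\theta)},\qquad n\to\infty,$$ $\mathrm{card}(T_{2n})\le(2n+1)^2=\dim\mathbb{P}_{2n}(S^2)$, and for all $n\ge1$ and $f\in C(S^2)$ the polynomial $\mathcal{L}^w_{T_{2n}}f$ exists, is unique and satisfies $$\|f-\mathcal{L}^w_{T_{2n}}f\|_{L^\infty(S^2)}\le(1+C_n)\min_{p\in\mathbb{P}_n(S^2)}\|f-p\|_{L^\infty(S^2)}.$$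 (b) Let $\mathcal{A}_n$ be the zonal equal area configuration of $M_n$ points (the centers of the cells of Leopardi's recursive zonal equal area partition of $S^2$ into $M_n$ cells, each collar being rotated about the polar axis by an arbitrary angle), where either $M_n=\lceil 49\,(n-\frac1{4\pi})^2\rceil$ for all $n\ge 1$, or $M_n=\lceil\sigma_n^2n^2\rceil$ with $\alpha=7/2$, $\theta=1/2$ for all $n\ge 1$. (For $N\ge3$ cells that partition is: two polar caps of area $4\pi/N$, hence of angular radius $\theta_c=2\arcsin(1/\sqrt N)$; $k=\max(1,\mathrm{round}((\pi-2\theta_c)/\sqrt{4\pi/N}))$ collars; $S_i=\mathrm{round}(N\sin^2((\theta_c+i\delta)/2))$ with $\delta=(\pi-2\theta_c)/k$, $0\le i\le k$; the $i$-th collar lies between the colatitudes $2\arcsin\sqrt{S_{i-1}/N}$ and $2\arcsin\sqrt{S_i/N}$ and is divided into $S_i-S_{i-1}$ equal longitudinal sectors. The centers are the two poles and the points of mean colatitude and mean longitude of the sectors.) Then all the assertions of (a) about the CATCH sets $T_{2n}$ extracted from $\mathcal{A}_n$ hold with $$C_n=\frac{14\,n}{1-(4\pi n)^{-1}}\sim14\,n,\qquad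 n\to\infty.$$ -/

import Mathlib

open Filter Asymptotics

noncomputable section

/-- The `i`-th coordinate as a continuous function on `K ⊆ ℝ^d`. -/
def coordOn {d : ℕ} (K : Set (EuclideanSpace ℝ (Fin d))) (i : Fin d) : C(K, ℝ) :=
  ⟨fun x => (x : EuclideanSpace ℝ (Fin d)) i, by fun_prop⟩

/-- `P_n^d(K)`: the real polynomials in `d` variables of total degree at most `n`,
restricted to `K`, as a subspace of `C(K)`. -/
def polySpace {d : ℕ} (n : ℕ) (K : Set (EuclideanSpace ℝ (Fin d))) : Submodule ℝ C(K, ℝ) :=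
  (MvPolynomial.restrictTotalDegree (Fin d) ℝ n).map
    (MvPolynomial.aeval (coordOn K)).toLinearMap

/-- The maximum of `|f|` over a finite set `T` of points of `K`. -/
def finSupNorm {d : ℕ} {K : Set (EuclideanSpace ℝ (Fin d))} (T : Finset K) (f : C(K, ℝ)) : ℝ :=
  ⨆ x : T, |f x|

/-- A sequence `T n` of finite subsets of `K` is a weakly admissible mesh with constants `C n`:
the norming inequality holds in every degree `n ≥ 1`, the cardinality is
`O((dim P_n)^β)` for some `β ≥ 1`, and `C n` grows at most polynomially. -/
structure IsWeaklyAdmissibleMesh {d : ℕ} (K : Set (EuclideanSpace ℝ (Fin d))) [CompactSpace K]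
    (T : ℕ → Finset K) (C : ℕ → ℝ) : Prop where
  norming : ∀ n, 1 ≤ n → ∀ p ∈ polySpace n K, ‖p‖ ≤ C n * finSupNorm (T n) p
  card_growth : ∃ β : ℝ, 1 ≤ β ∧
    (fun n => ((T n).card : ℝ)) =O[atTop]
      (fun n => (Module.finrank ℝ (polySpace n K) : ℝ) ^ β)
  const_growth : ∃ s : ℝ, 0 ≤ s ∧ C =O[atTop] (fun n : ℕ => (n : ℝ) ^ s)

/-- `T` with weights `w` is a set of Caratheodory-Tchakaloff quadrature points of degree `ν`,
extracted from the finite set `A ⊆ K` with unit masses: `T ⊆ A`, the weights are positive,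
`T` has at most `dim P_ν(A)` points, and the formula reproduces the sums over `A` of all
polynomials of degree at most `ν`. -/
structure IsCatch {d : ℕ} {K : Set (EuclideanSpace ℝ (Fin d))} (ν : ℕ) (A T : Finset K)
    (w : K → ℝ) : Prop where
  subset : T ⊆ A
  pos : ∀ t ∈ T, 0 < w t
  card_le : T.card ≤ Module.finrank ℝ
    (polySpace ν (Subtype.val '' (A : Set K) : Set (EuclideanSpace ℝ (Fin d))))
  exact_sum : ∀ p ∈ polySpace ν K, ∑ x ∈ A, p x = ∑ t ∈ T, w t * p t

/-- `q` is a weighted discrete least squares polynomial of degree `n` for `f` on `(T, w)`. -/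
def IsWeightedLS {d : ℕ} {K : Set (EuclideanSpace ℝ (Fin d))} (n : ℕ) (T : Finset K)
    (w : K → ℝ) (f q : C(K, ℝ)) : Prop :=
  q ∈ polySpace n K ∧
    ∀ p ∈ polySpace n K, ∑ t ∈ T, w t * (f t - q t) ^ 2 ≤ ∑ t ∈ T, w t * (f t - p t) ^ 2

/-- The error of best uniform approximation of `f` in `P_n(K)`. -/
def bestError {d : ℕ} {K : Set (EuclideanSpace ℝ (Fin d))} [CompactSpace K] (n : ℕ)
    (f : C(K, ℝ)) : ℝ :=
  ⨅ p : polySpace n K, ‖f - (p : C(K, ℝ))‖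

/-- The unit sphere of `ℝ³`. -/
abbrev S2 : Set (EuclideanSpace ℝ (Fin 3)) := Metric.sphere 0 1

/-- The covering radius of a finite set of points of the sphere, in the Euclidean distance. -/
def coveringRadius (X : Finset S2) : ℝ := ⨆ x : S2, Metric.infDist x (X : Set S2)

/-- `X M`, `M ≥ 2`, is a good covering of the sphere with constant `α`. -/
def IsGoodCovering (X : ℕ → Finset S2) (α : ℝ) : Prop :=
  ∀ M, 2 ≤ M → (X M).card = M ∧ coveringRadius (X M) ≤ α / √(M : ℝ)

/-- `σ_n = 2πα / (θ (2π - θ/n))`. -/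
def sigma (α θ : ℝ) (n : ℕ) : ℝ :=
  2 * Real.pi * α / (θ * (2 * Real.pi - θ / n))

/-- `M_n = ⌈σ_n² n²⌉`. -/
def meshSize (α θ : ℝ) (n : ℕ) : ℕ := ⌈sigma α θ n ^ 2 * (n : ℝ) ^ 2⌉₊

/-! Zonal equal area configurations: the centers of the cells of the recursive zonal equal
area partition of the sphere into `N` cells. -/

/-- The point of the sphere with colatitude `a` and longitude `l`. -/
def spherePoint (a l : ℝ) : S2 :=
  ⟨!₂[Real.sin a * Real.cos l, Real.sin a * Real.sin l, Real.cos a], by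
    rw [mem_sphere_zero_iff_norm, EuclideanSpace.norm_eq, Real.sqrt_eq_one]
    simp [Fin.sum_univ_three]
    nlinarith [Real.sin_sq_add_cos_sq a, Real.sin_sq_add_cos_sq l]⟩

/-- Colatitude of the boundary of the north polar cap, whose area is `4π/N`. (The area of
the cap of angular radius `a` is `4π sin²(a/2)`.) -/
def eqPolarAngle (N : ℕ) : ℝ := 2 * Real.arcsin (1 / √(N : ℝ))

/-- Number of collars between the two polar caps: the nearest integer to
`(π - 2 θ_c) / √(4π/N)`, but at least one; none if `N ≤ 2`. -/
def eqNumCollars (N : ℕ) : ℕ :=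
  if N ≤ 2 then 0
  else max 1 (round ((Real.pi - 2 * eqPolarAngle N) / √(4 * Real.pi / N))).toNat

/-- Number of cells in the north polar cap and the first `i` collars. The collars of equal
angular height `δ` would hold the ideal, fractional number `N sin²((θ_c + i δ)/2)` of cells
up to there. The number of cells of each collar is the nearest integer to its ideal number
plus the rounding discrepancy carried over from the previous collars; equivalently, the
partial sums are the rounded ideal partial sums. -/
def eqCapCount (N i : ℕ) : ℕ :=
  (round ((N : ℝ) * Real.sin ((eqPolarAngle N +
    i * ((Real.pi - 2 * eqPolarAngle N) / eqNumCollars N)) / 2) ^ 2)).toNat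

/-- Colatitude of the lower boundary of collar number `i` (of the polar cap, if `i = 0`):
the cap up to there has exactly the area of its cells. -/
def eqCapAngle (N i : ℕ) : ℝ := 2 * Real.arcsin (√((eqCapCount N i : ℝ) / N))

/-- Number of cells of the collar number `i + 1`. -/
def eqCollarCount (N i : ℕ) : ℕ := eqCapCount N (i + 1) - eqCapCount N i

open Classical in
/-- The zonal equal area configuration of `N` points: the two poles (centers of the polar
caps), and the centers of the cells of each collar, which is divided into sectors of equal
longitudinal width. The rotation `φ i` of each collar about the polar axis is left free.
For `N = 1` there is one cell, the whole sphere. -/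
def zonalPoints (N : ℕ) (φ : ℕ → ℝ) : Finset S2 :=
  if N = 0 then ∅
  else if N = 1 then {spherePoint 0 0}
  else {spherePoint 0 0, spherePoint Real.pi 0} ∪
    (Finset.range (eqNumCollars N)).biUnion fun i =>
      (Finset.range (eqCollarCount N i)).image fun k : ℕ =>
        spherePoint ((eqCapAngle N i + eqCapAngle N (i + 1)) / 2)
          (φ i + 2 * Real.pi * k / eqCollarCount N i)

end

/-! ### Bernstein's inequality for trigonometric polynomials -/

/-! Let `x` be a point where `|p|` attains its maximum over the sphere, with `p` of degree `n`.
Along a great circle through `x`, `p` is a trigonometric polynomial `u` of degree at most `n`.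
Bernstein's inequality, used twice, gives `|u''| ≤ n²‖p‖`. Since `u' = 0` at `x`, `|p|` is still at
least `(1 - t²/2)‖p‖` at angle `t/n` from `x` (`lower_bound_of_dist_le`). So a finite set `A` of
covering radius about `t/n` contains a point where `|p| ≥ c‖p‖`, with `c = 1 - t²/2`.

A CATCH set of degree `2n` reproduces the sum of `p²` over `A`, and its weights sum to `card A`.
Hence `(c‖p‖)² ≤ ∑_A p² = ∑_T w p² ≤ card A · max_T p²`, so any `C` with `card A ≤ (cC)²` is a
norming constant (`IsCatch.norming`). The same chain, applied to the difference of the least squares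
polynomial and a competitor, gives the error bound with factor `1 + C` (`IsCatch.leastSquares`).
CATCH sets exist by Caratheodory's theorem for evaluation functionals (`exists_isCatch`), and their
size is bounded through the decomposition `a(x,y) + z b(x,y)` of polynomials on the sphere.

What remains is to bound covering radius and cardinality. The stated constants correspond to the
weaker factor `1 - θ`. The gain from `1 - θ` to `1 - t²/2` leaves room for the ceiling in `M_n` when
the covering is good (`goodCovering_norming`). In the zonal case it also allows the crude covering
radius `5/√N` in place of `3.5/√N` (`exists_zonalPoint_dist_le`, `zonal_norming`). -/

/-- `f` is a trigonometric polynomial of degree at most `n` with complex coefficients. -/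
def IsTrigPoly (n : ℕ) (f : ℝ → ℂ) : Prop :=
  ∃ c : ℕ → ℂ, ∀ t : ℝ, f t =
    ∑ M ∈ Finset.range (2 * n + 1), c M * Complex.exp (((M : ℤ) - n : ℤ) * t * Complex.I)

/-- The nodes of Riesz' interpolation formula. -/
noncomputable def rieszNode (n k : ℕ) : ℝ := (2 * k + 1) * Real.pi / (2 * n)

/-- A geometric sum whose ratio `ω` is a `2n`-th root of unity, different from 1 unless `2n` divides
`s`. -/
lemma sum_exp_rieszNode_eq_zero {n : ℕ} (hn : 1 ≤ n) {s : ℤ} (hs : ¬ (2 * n : ℤ) ∣ s) :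
    ∑ k ∈ Finset.range (2 * n), Complex.exp (s * rieszNode n k * Complex.I) = 0 := by
  have hn0 : (n : ℂ) ≠ 0 := by exact_mod_cast (by omega : n ≠ 0)
  set ω : ℂ := Complex.exp (2 * Real.pi * Complex.I * (s / (2 * n))) with hω
  have h1 : ∀ k : ℕ, Complex.exp (s * rieszNode n k * Complex.I) =
      Complex.exp (Real.pi * Complex.I * (s / (2 * n))) * ω ^ k := by
    intro k
    rw [hω, ← Complex.exp_nat_mul, ← Complex.exp_add]
    congr 1
    simp only [rieszNode]
    push_cast
    field_simp
    ring
  simp_rw [h1]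
  rw [← Finset.mul_sum]
  have hω1 : ω ≠ 1 := by
    intro h
    rw [hω, Complex.exp_eq_one_iff] at h
    obtain ⟨m, hm⟩ := h
    apply hs
    refine ⟨m, ?_⟩
    have hpi : (2 * Real.pi * Complex.I : ℂ) ≠ 0 := Complex.two_pi_I_ne_zero
    have : (s : ℂ) / (2 * n) = m := by
      apply mul_left_cancel₀ hpi
      rw [hm]; ring
    field_simp at this
    have h2 : (s : ℂ) = ((2 * n * m : ℤ) : ℂ) := by push_cast; rw [this]
    exact_mod_cast h2
  have hω2 : ω ^ (2 * n) = 1 := by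
    rw [hω, ← Complex.exp_nat_mul, Complex.exp_eq_one_iff]
    refine ⟨s, ?_⟩
    push_cast
    field_simp
  rw [geom_sum_eq hω1, hω2]
  simp

lemma sum_exp_rieszNode_two_mul {n : ℕ} (hn : 1 ≤ n) :
    ∑ k ∈ Finset.range (2 * n), Complex.exp ((2 * n : ℤ) * rieszNode n k * Complex.I)
      = -(2 * n) := by
  have hn0 : (n : ℂ) ≠ 0 := by exact_mod_cast (by omega : n ≠ 0)
  have : ∀ k : ℕ, Complex.exp ((2 * n : ℤ) * rieszNode n k * Complex.I) = -1 := by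
    intro k
    have : ((2 * n : ℤ) * rieszNode n k * Complex.I : ℂ) =
        Real.pi * Complex.I + k * (2 * Real.pi * Complex.I) := by
      simp only [rieszNode]; push_cast; field_simp; ring
    rw [this, Complex.exp_add, Complex.exp_nat_mul, Complex.exp_two_pi_mul_I, Complex.exp_pi_mul_I]
    simp
  simp_rw [this]
  simp

/-- The only multiples of `2n` in the allowed range are `0` and `2n`. The half-step shift of the
nodes makes the second contribute with a minus sign. -/
lemma sum_exp_rieszNode {n : ℕ} (hn : 1 ≤ n) {s : ℤ} (h1 : -(2 * n : ℤ) < s) (h2 : s < 4 * n) :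
    ∑ k ∈ Finset.range (2 * n), Complex.exp (s * rieszNode n k * Complex.I)
      = 2 * n * ((if s = 0 then 1 else 0) - (if s = 2 * n then 1 else 0)) := by
  by_cases h0 : s = 0
  · subst h0
    have : (0 : ℤ) ≠ 2 * n := by omega
    simp [this]
  by_cases h3 : s = 2 * n
  · rw [h3, sum_exp_rieszNode_two_mul hn]
    have : (2 * n : ℤ) ≠ 0 := by omega
    simp only [this, if_true, if_false]; ring
  · rw [sum_exp_rieszNode_eq_zero hn]
    · simp [h0, h3]
    · rintro ⟨m, rfl⟩
      have hn' : (0 : ℤ) < 2 * n := by omega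
      have a1 : -1 < m := by nlinarith
      have a2 : m < 2 := by nlinarith
      interval_cases m <;> simp_all

/-- The (unnormalized) Fejér kernel. -/
noncomputable def fejer (n : ℕ) (t : ℝ) : ℝ :=
  Complex.normSq (∑ a ∈ Finset.range n, Complex.exp (a * t * Complex.I))

lemma fejer_eq (n : ℕ) (t : ℝ) : (fejer n t : ℂ) =
    ∑ a ∈ Finset.range n, ∑ b ∈ Finset.range n,
      Complex.exp (((a : ℤ) - b : ℤ) * t * Complex.I) := by
  rw [fejer, ← Complex.mul_conj, map_sum, Finset.sum_mul_sum]
  refine Finset.sum_congr rfl fun a _ => Finset.sum_congr rfl fun b _ => ?_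
  rw [← Complex.exp_conj, ← Complex.exp_add]
  congr 1
  simp
  ring

/-- The difference `a - b = j` occurs `n - |j|` times. For `M ≤ n` only the first indicator
contributes, giving `n - M`. For `M ≥ n` only the second does, giving `-(M - n)`. The sign change at
the nodes thus turns the Fejér tent into a linear function of `M`. -/
lemma card_sub_card {n M : ℕ} (hM : M ≤ 2 * n) :
    (∑ a ∈ Finset.range n, ∑ b ∈ Finset.range n,
      ((if (M : ℤ) + (a - b) = 0 then (1 : ℂ) else 0) -
        (if (M : ℤ) + (a - b) = 2 * n then 1 else 0))) = (n : ℂ) - M := by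
  simp_rw [Finset.sum_sub_distrib]
  have h1 : ∀ a ∈ Finset.range n, (∑ b ∈ Finset.range n,
      if (M : ℤ) + (a - b) = 0 then (1 : ℂ) else 0) = if a < n - M then 1 else 0 := by
    intro a ha
    rw [Finset.mem_range] at ha
    have : ∀ b : ℕ, ((M : ℤ) + (a - b) = 0) ↔ (b = M + a) := by intro b; omega
    simp_rw [this, Finset.sum_ite_eq', Finset.mem_range]
    congr 1
    simp only [eq_iff_iff]; omega
  have h2 : ∀ a ∈ Finset.range n, (∑ b ∈ Finset.range n,
      if (M : ℤ) + (a - b) = 2 * n then (1 : ℂ) else 0) = if 2 * n ≤ M + a then 1 else 0 := by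
    intro a ha
    rw [Finset.mem_range] at ha
    have : ∀ b : ℕ, ((M : ℤ) + (a - b) = 2 * n) ↔ (2 * n ≤ M + a ∧ b = M + a - 2 * n) := by
      intro b; omega
    by_cases h : 2 * n ≤ M + a
    · simp_rw [this, h, true_and, Finset.sum_ite_eq', Finset.mem_range]
      rw [if_pos (by omega)]; simp
    · simp_rw [this, h]; simp
  rw [Finset.sum_congr rfl h1, Finset.sum_congr rfl h2]
  rw [Finset.sum_boole, Finset.sum_boole]
  have e1 : (Finset.range n).filter (fun a => a < n - M) = Finset.range (n - M) := by
    ext a; simp; omega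
  have e2 : (Finset.range n).filter (fun a => 2 * n ≤ M + a) = Finset.Ico (2 * n - M) n := by
    ext a; simp; omega
  rw [e1, e2]
  simp only [Finset.card_range, Nat.card_Ico]
  rcases le_total M n with h | h
  · have : n - (2 * n - M) = 0 := by omega
    rw [this, Nat.cast_sub h]; simp
  · have : n - (2 * n - M) = M - n := by omega
    rw [this, Nat.cast_sub h, Nat.sub_eq_zero_of_le h]; simp

lemma sum_exp_mul_fejer {n : ℕ} (hn : 1 ≤ n) {M : ℕ} (hM : M ≤ 2 * n) :
    ∑ k ∈ Finset.range (2 * n), Complex.exp (M * rieszNode n k * Complex.I) *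
      fejer n (rieszNode n k) = 2 * n * (n - M) := by
  simp_rw [fejer_eq, Finset.mul_sum]
  rw [Finset.sum_comm]
  rw [← card_sub_card hM, Finset.mul_sum]
  refine Finset.sum_congr rfl fun a ha => ?_
  rw [Finset.sum_comm, Finset.mul_sum]
  refine Finset.sum_congr rfl fun b hb => ?_
  rw [Finset.mem_range] at ha hb
  rw [← sum_exp_rieszNode hn (by omega) (by omega)]
  refine Finset.sum_congr rfl fun k _ => ?_
  rw [← Complex.exp_add]
  congr 1
  push_cast
  ring

lemma sum_fejer {n : ℕ} (hn : 1 ≤ n) :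
    ∑ k ∈ Finset.range (2 * n), fejer n (rieszNode n k) = 2 * n * n := by
  have := sum_exp_mul_fejer hn (M := 0) (by omega)
  simp at this
  exact_mod_cast this

/-- Bernstein's inequality. -/
lemma IsTrigPoly.bernstein {n : ℕ} (hn : 1 ≤ n) {f : ℝ → ℂ} (hf : IsTrigPoly n f) {B : ℝ}
    (hB : ∀ t, ‖f t‖ ≤ B) :
    ∃ g, IsTrigPoly n g ∧ (∀ t, HasDerivAt f (g t) t) ∧ ∀ t, ‖g t‖ ≤ n * B := by
  obtain ⟨c, hc⟩ := hf
  have hnR : (0 : ℝ) < n := by exact_mod_cast hn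
  refine ⟨fun t => ∑ M ∈ Finset.range (2 * n + 1), (c M * (((M : ℤ) - n : ℤ) * Complex.I)) *
    Complex.exp (((M : ℤ) - n : ℤ) * t * Complex.I), ⟨_, fun t => rfl⟩, ?_, ?_⟩
  · intro t
    have hfe : f = fun t : ℝ => ∑ M ∈ Finset.range (2 * n + 1),
        c M * Complex.exp (((M : ℤ) - n : ℤ) * t * Complex.I) := funext hc
    rw [hfe]
    refine HasDerivAt.fun_sum fun M _ => ?_
    have h1 : HasDerivAt (fun t : ℝ => (((M : ℤ) - n : ℤ) * t * Complex.I : ℂ))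
        (((M : ℤ) - n : ℤ) * Complex.I) t := by
      have := ((Complex.ofRealCLM.hasDerivAt (x := t)).const_mul
        (((M : ℤ) - n : ℤ) : ℂ)).mul_const Complex.I
      simpa using this
    have := (h1.cexp).const_mul (c M)
    exact this.congr_deriv (by ring)
  · intro x
    -- Riesz' interpolation formula for `2n i f'(x)`: at frequency `M - n` the nodal sum is `2n(n -
    -- M)`, which is `2n i` times the factor `i(M - n)` of differentiation. The moduli of the
    -- coefficients are Fejér values with sum `2n²`, whence the constant `n`.
    have key : ∑ k ∈ Finset.range (2 * n), f (x + rieszNode n k) *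
        (Complex.exp (n * rieszNode n k * Complex.I) * fejer n (rieszNode n k)) =
        2 * n * Complex.I * ∑ M ∈ Finset.range (2 * n + 1),
          (c M * (((M : ℤ) - n : ℤ) * Complex.I)) *
            Complex.exp (((M : ℤ) - n : ℤ) * x * Complex.I) := by
      simp_rw [hc, Finset.sum_mul]
      rw [Finset.sum_comm, Finset.mul_sum]
      refine Finset.sum_congr rfl fun M hM => ?_
      rw [Finset.mem_range] at hM
      have h1 := sum_exp_mul_fejer hn (M := M) (by omega)
      calc _ = ∑ k ∈ Finset.range (2 * n), (c M *
            Complex.exp (((M : ℤ) - n : ℤ) * x * Complex.I)) *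
            (Complex.exp (M * rieszNode n k * Complex.I) * fejer n (rieszNode n k)) := by
            refine Finset.sum_congr rfl fun k _ => ?_
            have : Complex.exp (((M : ℤ) - n : ℤ) * (x + rieszNode n k : ℝ) * Complex.I) *
                Complex.exp (n * rieszNode n k * Complex.I) =
                Complex.exp (((M : ℤ) - n : ℤ) * x * Complex.I) *
                Complex.exp (M * rieszNode n k * Complex.I) := by
              rw [← Complex.exp_add, ← Complex.exp_add]
              congr 1
              push_cast
              ring
            linear_combination (c M * fejer n (rieszNode n k)) * this
        _ = _ := by
          rw [← Finset.mul_sum, h1]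
          push_cast
          linear_combination (-2 * n * (c M) * (M - n) *
            Complex.exp ((M - n) * x * Complex.I)) * Complex.I_mul_I
    set G := ∑ M ∈ Finset.range (2 * n + 1),
          (c M * (((M : ℤ) - n : ℤ) * Complex.I)) *
            Complex.exp (((M : ℤ) - n : ℤ) * x * Complex.I) with hG
    have h2 : ‖2 * n * Complex.I * G‖ ≤ ∑ k ∈ Finset.range (2 * n),
        B * fejer n (rieszNode n k) := by
      rw [← key]
      refine (norm_sum_le _ _).trans (Finset.sum_le_sum fun k _ => ?_)
      have hfn : 0 ≤ fejer n (rieszNode n k) := Complex.normSq_nonneg _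
      have he : ‖Complex.exp (n * rieszNode n k * Complex.I)‖ = 1 := by
        have := Complex.norm_exp_ofReal_mul_I (n * rieszNode n k)
        simpa using this
      rw [norm_mul, norm_mul, he, one_mul, Complex.norm_real, Real.norm_of_nonneg hfn]
      exact mul_le_mul_of_nonneg_right (hB _) hfn
    rw [← Finset.mul_sum, sum_fejer hn] at h2
    have h3 : ‖2 * n * Complex.I * G‖ = 2 * n * ‖G‖ := by
      simp
    rw [h3] at h2
    show ‖G‖ ≤ n * B
    have : 2 * n * ‖G‖ ≤ 2 * n * (n * B) := by linarith
    exact le_of_mul_le_mul_left this (by positivity)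

/-- Near a point where a real trigonometric polynomial attains its maximum modulus, it stays
above a parabola. -/
lemma IsTrigPoly.lower_bound {n : ℕ} (hn : 1 ≤ n) {u : ℝ → ℝ}
    (hu : IsTrigPoly n (fun t => (u t : ℂ))) {B : ℝ} (hB : ∀ t, |u t| ≤ B) (h0 : u 0 = B)
    {t : ℝ} (ht : 0 ≤ t) : B * (1 - (n * t) ^ 2 / 2) ≤ u t := by
  obtain ⟨g, hg, hd, hgB⟩ := hu.bernstein hn (B := B) (fun t => by simpa using hB t)
  obtain ⟨g', hg', hd', hgB'⟩ := hg.bernstein hn hgB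
  have hre : ∀ {v : ℝ → ℂ} {v' : ℂ} {t : ℝ}, HasDerivAt v v' t →
      HasDerivAt (fun t => (v t).re) v'.re t := fun h =>
    Complex.reCLM.hasFDerivAt.comp_hasDerivAt _ h
  have hud : ∀ t, HasDerivAt u (g t).re t := fun t => by simpa using hre (hd t)
  have hgd : ∀ t, HasDerivAt (fun t => (g t).re) (g' t).re t := fun t => hre (hd' t)
  have hz : (g 0).re = 0 := by
    refine IsLocalMax.hasDerivAt_eq_zero (f := u) (a := 0) ?_ (hud 0)
    exact Filter.Eventually.of_forall fun t => by rw [h0]; exact (le_abs_self _).trans (hB t)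
  -- The bound `u'' ≥ -n²B` is integrated twice from `0`, in the form of two monotonicity
  -- statements.
  have h1 : Monotone (fun t => (g t).re + n * (n * B) * t) := by
    refine monotone_of_hasDerivAt_nonneg (f' := fun t => (g' t).re + n * (n * B) * 1)
      (fun t => (hgd t).add ((hasDerivAt_id t).const_mul _)) fun t => ?_
    have := (Complex.abs_re_le_norm (g' t)).trans (hgB' t)
    have := (abs_le.mp this).1
    show (0 : ℝ) ≤ (g' t).re + n * (n * B) * 1
    linarith
  have h2 : MonotoneOn (fun t => u t + n * (n * B) * (t ^ 2 / 2)) (Set.Ici 0) := by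
    have hder : ∀ t, HasDerivAt (fun t => u t + n * (n * B) * (t ^ 2 / 2))
        ((g t).re + n * (n * B) * t) t := fun t => by
      have := ((hasDerivAt_pow 2 t).div_const 2).const_mul (n * (n * B))
      exact ((hud t).add this).congr_deriv (by norm_num)
    refine monotoneOn_of_deriv_nonneg (convex_Ici 0)
      (fun t _ => (hder t).continuousAt.continuousWithinAt)
      (fun t _ => (hder t).differentiableAt.differentiableWithinAt) fun t ht => ?_
    rw [(hder t).deriv]
    have := h1 (show (0 : ℝ) ≤ t by simpa using interior_subset ht)
    simpa [hz] using this
  have := h2 (Set.self_mem_Ici) (show t ∈ Set.Ici 0 from ht) ht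
  simp only [h0] at this
  linarith

/-! ### Polynomials on the sphere along great circles -/

lemma isTrigPoly_of_polynomial {n : ℕ} {f : ℝ → ℂ} (Q : Polynomial ℂ) (hQ : Q.natDegree ≤ 2 * n)
    (h : ∀ t : ℝ, f t * Complex.exp (t * Complex.I) ^ n = Q.eval (Complex.exp (t * Complex.I))) :
    IsTrigPoly n f := by
  refine ⟨Q.coeff, fun t => ?_⟩
  have h1 := h t
  rw [Polynomial.eval_eq_sum_range' (n := 2 * n + 1) (by omega)] at h1
  have hne : Complex.exp (t * Complex.I) ^ n ≠ 0 := pow_ne_zero _ (Complex.exp_ne_zero _)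
  apply mul_right_cancel₀ hne
  rw [h1, Finset.sum_mul]
  refine Finset.sum_congr rfl fun M _ => ?_
  rw [mul_assoc]
  congr 1
  rw [← Complex.exp_nat_mul, ← Complex.exp_nat_mul, ← Complex.exp_add]
  congr 1
  push_cast
  ring

-- With `z = e^{it}`, each coordinate times `z` is a quadratic in `z`. A monomial of degree `|e|`
-- times `z^n` therefore has degree at most `2|e| + (n - |e|) ≤ 2n`.
open Polynomial in
lemma isTrigPoly_eval {d n : ℕ} (P : MvPolynomial (Fin d) ℝ) (hP : P.totalDegree ≤ n)
    (a b : Fin d → ℝ) :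
    IsTrigPoly n (fun t => ((MvPolynomial.eval
      (fun i => Real.cos t * a i + Real.sin t * b i) P : ℝ) : ℂ)) := by
  set q : Fin d → ℂ[X] := fun i =>
    C (((a i : ℂ) - Complex.I * b i) / 2) * X ^ 2 + C (((a i : ℂ) + Complex.I * b i) / 2) with hq
  have hqdeg : ∀ i, (q i).natDegree ≤ 2 := fun i => by
    simp only [hq]; compute_degree
  have hqe : ∀ i (t : ℝ), ((Real.cos t * a i + Real.sin t * b i : ℝ) : ℂ) *
      Complex.exp (t * Complex.I) = (q i).eval (Complex.exp (t * Complex.I)) := by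
    intro i t
    have h1 := Complex.cos_sq_add_sin_sq (t : ℂ)
    simp only [hq, eval_add, eval_mul, eval_C, eval_pow, eval_X, Complex.exp_mul_I]
    push_cast
    linear_combination ((a i : ℂ) / 2 + Complex.I * b i / 2) * h1 +
      (-(a i : ℂ) / 2 * Complex.sin t ^ 2 + Complex.I * b i / 2 * Complex.sin t ^ 2
        + (b i : ℂ) * Complex.sin t * Complex.cos t) * Complex.I_sq
  refine isTrigPoly_of_polynomial (∑ e ∈ P.support, C ((P.coeff e : ℝ) : ℂ) *
    ((∏ i, q i ^ e i) * X ^ (n - ∑ i, e i))) ?_ fun t => ?_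
  · refine natDegree_sum_le_of_forall_le _ _ fun e he => ?_
    have hen : ∑ i, e i ≤ n := by
      have := (MvPolynomial.le_totalDegree he).trans hP
      rwa [Finsupp.sum_fintype _ _ (by simp)] at this
    refine (natDegree_C_mul_le _ _).trans (natDegree_mul_le.trans ?_)
    have h2 : (∏ i, q i ^ e i).natDegree ≤ ∑ i, 2 * e i := by
      refine (natDegree_prod_le _ _).trans (Finset.sum_le_sum fun i _ => ?_)
      refine natDegree_pow_le.trans ?_
      have := hqdeg i
      nlinarith
    rw [← Finset.mul_sum] at h2
    rw [natDegree_X_pow]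
    omega
  · rw [eval_finsetSum, MvPolynomial.eval_eq', Complex.ofReal_sum, Finset.sum_mul]
    refine Finset.sum_congr rfl fun e he => ?_
    have hen : ∑ i, e i ≤ n := by
      have := (MvPolynomial.le_totalDegree he).trans hP
      rwa [Finsupp.sum_fintype _ _ (by simp)] at this
    rw [eval_mul, eval_C, eval_mul, eval_prod, eval_pow, eval_X]
    simp_rw [eval_pow, ← hqe, mul_pow]
    rw [Finset.prod_mul_distrib, Finset.prod_pow_eq_pow_sum, mul_assoc, ← pow_add,
      Nat.add_sub_cancel' hen]
    push_cast
    ring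

lemma mem_polySpace {d n : ℕ} {K : Set (EuclideanSpace ℝ (Fin d))} {p : C(K, ℝ)} :
    p ∈ polySpace n K ↔ ∃ P : MvPolynomial (Fin d) ℝ, P.totalDegree ≤ n ∧
      MvPolynomial.aeval (coordOn K) P = p := by
  simp [polySpace, MvPolynomial.mem_restrictTotalDegree]

lemma aeval_coordOn_apply {d : ℕ} {K : Set (EuclideanSpace ℝ (Fin d))}
    (P : MvPolynomial (Fin d) ℝ) (x : K) :
    MvPolynomial.aeval (coordOn K) P x =
      MvPolynomial.eval (fun i => (x : EuclideanSpace ℝ (Fin d)) i) P := by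
  have := MvPolynomial.comp_aeval_apply (coordOn K) (ContinuousMap.evalAlgHom ℝ ℝ x) P
  simp only [ContinuousMap.evalAlgHom_apply] at this
  rw [this, ← MvPolynomial.coe_aeval_eq_eval]
  rfl

lemma lower_bound_of_dist_eq {n : ℕ} (hn : 1 ≤ n) {p : C(S2, ℝ)} (hp : p ∈ polySpace n S2)
    {x y : S2} (hx : p x = ‖p‖) {g : ℝ} (hg0 : 0 ≤ g) (hgπ : g < Real.pi)
    (hxy : dist x y = 2 * Real.sin (g / 2)) : ‖p‖ * (1 - (n * g) ^ 2 / 2) ≤ p y := by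
  obtain ⟨P, hP, rfl⟩ := mem_polySpace.mp hp
  set p := MvPolynomial.aeval (coordOn S2) P with hpdef
  have hnx : ‖(x : EuclideanSpace ℝ (Fin 3))‖ = 1 := by simp
  have hny : ‖(y : EuclideanSpace ℝ (Fin 3))‖ = 1 := by simp
  rcases hg0.eq_or_lt with rfl | hg
  · have : x = y := by rw [← dist_eq_zero, hxy]; simp
    rw [← this, hx]; simp
  have hs : 0 < Real.sin g := Real.sin_pos_of_pos_of_lt_pi hg hgπ
  have hin : inner ℝ (x : EuclideanSpace ℝ (Fin 3)) y = Real.cos g := by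
    have h1 := norm_sub_sq_real (x : EuclideanSpace ℝ (Fin 3)) y
    rw [← dist_eq_norm, ← Subtype.dist_eq, hxy, hnx, hny] at h1
    have h2 : Real.cos g = 1 - 2 * Real.sin (g / 2) ^ 2 := by
      have := Real.cos_two_mul' (g / 2)
      rw [mul_div_cancel₀ _ (two_ne_zero)] at this
      have := Real.sin_sq_add_cos_sq (g / 2)
      linarith
    rw [h2]; linarith
  -- The unit tangent at `x` towards `y`; the great circle `cos t • x + sin t • v` reaches `y` at `t
  -- = g`.
  set v : EuclideanSpace ℝ (Fin 3) := (Real.sin g)⁻¹ • ((y : EuclideanSpace ℝ (Fin 3)) -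
    Real.cos g • (x : EuclideanSpace ℝ (Fin 3))) with hv
  have hxv : inner ℝ (x : EuclideanSpace ℝ (Fin 3)) v = 0 := by
    rw [hv, inner_smul_right, inner_sub_right, inner_smul_right, hin,
      real_inner_self_eq_norm_sq, hnx]
    ring
  have hnv : ‖v‖ ^ 2 = 1 := by
    rw [hv, norm_smul, mul_pow, norm_sub_sq_real, inner_smul_right, real_inner_comm, hin,
      norm_smul, hnx, hny, Real.norm_eq_abs, Real.norm_eq_abs, mul_one, sq_abs, sq_abs]
    field_simp
    have := Real.sin_sq_add_cos_sq g
    linarith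
  have hγ : ∀ t : ℝ, Real.cos t • (x : EuclideanSpace ℝ (Fin 3)) + Real.sin t • v ∈ S2 := by
    intro t
    rw [mem_sphere_zero_iff_norm, ← sq_eq_sq₀ (norm_nonneg _) zero_le_one, norm_add_sq_real,
      inner_smul_left, inner_smul_right, hxv, norm_smul, norm_smul, mul_pow, mul_pow, hnv, hnx,
      Real.norm_eq_abs, Real.norm_eq_abs, sq_abs, sq_abs]
    have := Real.sin_sq_add_cos_sq t
    simp only [mul_zero, one_pow, mul_one, add_zero]
    linarith
  have hpe : ∀ t : ℝ, MvPolynomial.eval (fun i => Real.cos t *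
      (x : EuclideanSpace ℝ (Fin 3)) i + Real.sin t * v i) P = p ⟨_, hγ t⟩ := by
    intro t
    rw [hpdef, aeval_coordOn_apply]
    rfl
  have key := (isTrigPoly_eval P hP (fun i => (x : EuclideanSpace ℝ (Fin 3)) i)
    (fun i => v i)).lower_bound hn (B := ‖p‖)
    (fun t => by rw [hpe]; exact p.norm_coe_le_norm _)
    (by
      rw [hpe, ← hx]
      congr 1
      ext1
      simp) hg.le
  rw [hpe] at key
  have hy : (⟨_, hγ g⟩ : S2) = y := by
    ext1
    simp only [hv]
    rw [smul_smul, mul_inv_cancel₀ hs.ne']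
    simp
  rwa [hy] at key

/-- A polynomial of degree `n` on the sphere is bounded below near its maximum points. -/
lemma lower_bound_of_dist_le {n : ℕ} (hn : 1 ≤ n) {p : C(S2, ℝ)} (hp : p ∈ polySpace n S2)
    {x y : S2} (hx : |p x| = ‖p‖) {t : ℝ} (ht0 : 0 ≤ t) (ht1 : t ≤ 1)
    (hxy : dist x y ≤ t * (1 - t / (2 * Real.pi))) : ‖p‖ * (1 - (n * t) ^ 2 / 2) ≤ |p y| := by
  have hpi := Real.pi_gt_three
  have hpi4 := Real.pi_le_four
  -- The hypothesis bounds a chord, whereas the parabola needs the angle. The given bound is below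
  -- the chord of angle `t`, since the loss `t²/(2π) ≥ t²/8` exceeds the cubic term `t³/24` of the
  -- sine.
  have hsin : t * (1 - t / (2 * Real.pi)) ≤ 2 * Real.sin (t / 2) := by
    rcases ht0.eq_or_lt with rfl | ht
    · simp
    have h1 := Real.sin_gt_sub_cube (x := t / 2) (by linarith)
    have h2 : t / (2 * Real.pi) ≥ t / 8 := by
      apply div_le_div_of_nonneg_left <;> linarith
    nlinarith [mul_le_mul_of_nonneg_left h2 ht.le, mul_nonneg (mul_nonneg ht.le ht.le)
      (sub_nonneg.2 ht1)]
  set g := 2 * Real.arcsin (dist x y / 2) with hg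
  have hd0 : 0 ≤ dist x y := dist_nonneg
  have hgt : g ≤ t := by
    have : Real.arcsin (dist x y / 2) ≤ t / 2 := by
      rw [Real.arcsin_le_iff_le_sin']
      · linarith
      · constructor <;> linarith
    linarith
  have hg0 : 0 ≤ g := by
    have := Real.arcsin_nonneg.mpr (show 0 ≤ dist x y / 2 by linarith)
    linarith
  have hdg : dist x y = 2 * Real.sin (g / 2) := by
    have := Real.sin_le_one (t / 2)
    rw [hg, mul_div_cancel_left₀ _ (two_ne_zero), Real.sin_arcsin (by linarith) (by linarith)]
    ring
  have h1 : ‖p‖ * (1 - (n * t) ^ 2 / 2) ≤ ‖p‖ * (1 - (n * g) ^ 2 / 2) := by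
    gcongr
  refine h1.trans ?_
  rcases abs_choice (p x) with h | h
  · exact (lower_bound_of_dist_eq hn hp (by rw [← h, hx]) hg0 (by linarith) hdg).trans
      (le_abs_self _)
  · have := lower_bound_of_dist_eq hn (Submodule.neg_mem _ hp) (x := x) (y := y) (g := g)
      (by rw [norm_neg, ← hx, h]; rfl) hg0 (by linarith) hdg
    rw [norm_neg] at this
    exact this.trans (neg_le_abs _)

lemma exists_abs_eq_norm (p : C(S2, ℝ)) : ∃ x, |p x| = ‖p‖ := by
  have : Nonempty S2 := ⟨spherePoint 0 0⟩
  obtain ⟨x, hx⟩ := (continuous_abs.comp p.continuous).exists_forall_ge_of_hasCompactSupport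
    (HasCompactSupport.of_compactSpace _)
  refine ⟨x, le_antisymm (p.norm_coe_le_norm x) ?_⟩
  rw [ContinuousMap.norm_le _ (abs_nonneg _)]
  exact hx

/-! ### Weighted least squares on Caratheodory-Tchakaloff points -/

instance finiteDimensional_polySpace {d n : ℕ} {K : Set (EuclideanSpace ℝ (Fin d))} :
    FiniteDimensional ℝ (polySpace n K) := by
  unfold polySpace
  infer_instance

lemma one_mem_polySpace {d n : ℕ} {K : Set (EuclideanSpace ℝ (Fin d))} :
    (1 : C(K, ℝ)) ∈ polySpace n K :=
  mem_polySpace.mpr ⟨1, by simp, by simp⟩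

lemma mul_mem_polySpace {d m n : ℕ} {K : Set (EuclideanSpace ℝ (Fin d))} {p q : C(K, ℝ)}
    (hp : p ∈ polySpace m K) (hq : q ∈ polySpace n K) : p * q ∈ polySpace (m + n) K := by
  obtain ⟨P, hP, rfl⟩ := mem_polySpace.mp hp
  obtain ⟨Q, hQ, rfl⟩ := mem_polySpace.mp hq
  exact mem_polySpace.mpr ⟨P * Q, (MvPolynomial.totalDegree_mul _ _).trans (by omega), by simp⟩

lemma abs_le_finSupNorm {d : ℕ} {K : Set (EuclideanSpace ℝ (Fin d))} {T : Finset K} {t : K}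
    (ht : t ∈ T) (f : C(K, ℝ)) : |f t| ≤ finSupNorm T f :=
  le_ciSup (f := fun x : T => |f x|) (Set.finite_range _).bddAbove ⟨t, ht⟩

lemma finSupNorm_nonneg {d : ℕ} {K : Set (EuclideanSpace ℝ (Fin d))} (T : Finset K)
    (f : C(K, ℝ)) : 0 ≤ finSupNorm T f :=
  Real.iSup_nonneg fun _ => abs_nonneg _

section Catch

variable {d n : ℕ} {K : Set (EuclideanSpace ℝ (Fin d))} {A T : Finset K} {w : K → ℝ}

lemma IsCatch.sum_weights {ν : ℕ} (h : IsCatch ν A T w) : ∑ t ∈ T, w t = A.card := by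
  have := h.exact_sum 1 one_mem_polySpace
  simpa using this.symm

lemma IsCatch.sum_sq (h : IsCatch (2 * n) A T w) {p : C(K, ℝ)} (hp : p ∈ polySpace n K) :
    ∑ x ∈ A, p x ^ 2 = ∑ t ∈ T, w t * p t ^ 2 := by
  have hm := mul_mem_polySpace hp hp
  rw [← two_mul] at hm
  have := h.exact_sum _ hm
  simpa [sq] using this

/-- The weighted `ℓ²` norm on a Caratheodory-Tchakaloff set controls the uniform norm. -/
lemma IsCatch.norm_sq_le [CompactSpace K] (h : IsCatch (2 * n) A T w) {c : ℝ} (hc : 0 < c)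
    (hA : ∀ p ∈ polySpace n K, ∃ y ∈ A, c * ‖p‖ ≤ |p y|) {p : C(K, ℝ)}
    (hp : p ∈ polySpace n K) : (c * ‖p‖) ^ 2 ≤ ∑ t ∈ T, w t * p t ^ 2 := by
  obtain ⟨y, hy, hle⟩ := hA p hp
  rw [← h.sum_sq hp]
  calc (c * ‖p‖) ^ 2 ≤ |p y| ^ 2 := by gcongr
    _ = p y ^ 2 := sq_abs _
    _ ≤ _ := Finset.single_le_sum (f := fun x => p x ^ 2) (fun x _ => sq_nonneg _) hy

lemma IsCatch.sum_sq_le {ν : ℕ} (h : IsCatch ν A T w) {f : C(K, ℝ)} {B : ℝ}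
    (hB : ∀ t ∈ T, |f t| ≤ B) : ∑ t ∈ T, w t * f t ^ 2 ≤ A.card * B ^ 2 := by
  rw [← h.sum_weights, Finset.sum_mul]
  refine Finset.sum_le_sum fun t ht => mul_le_mul_of_nonneg_left ?_ (h.pos t ht).le
  rw [← sq_abs]
  exact pow_le_pow_left₀ (abs_nonneg _) (hB t ht) 2

lemma norm_le_of_sq_le {c C N B x : ℝ} (hc : 0 < c) (hx : 0 ≤ x) (hB : 0 ≤ B) (hC : 0 ≤ C)
    (hN : N ≤ (c * C) ^ 2) (h : (c * x) ^ 2 ≤ N * B ^ 2) : x ≤ C * B := by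
  have h1 : (c * x) ^ 2 ≤ (c * (C * B)) ^ 2 := by
    calc _ ≤ N * B ^ 2 := h
      _ ≤ (c * C) ^ 2 * B ^ 2 := by gcongr
      _ = _ := by ring
  have h2 := (sq_le_sq₀ (by positivity) (by positivity)).mp h1
  exact le_of_mul_le_mul_left h2 hc

lemma IsCatch.norming [CompactSpace K] (h : IsCatch (2 * n) A T w) {c C : ℝ} (hc : 0 < c)
    (hA : ∀ p ∈ polySpace n K, ∃ y ∈ A, c * ‖p‖ ≤ |p y|) (hC : 0 ≤ C)
    (hN : (A.card : ℝ) ≤ (c * C) ^ 2) {p : C(K, ℝ)} (hp : p ∈ polySpace n K) :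
    ‖p‖ ≤ C * finSupNorm T p :=
  norm_le_of_sq_le hc (norm_nonneg _) (finSupNorm_nonneg _ _) hC hN
    ((h.norm_sq_le hc hA hp).trans (h.sum_sq_le fun _ ht => abs_le_finSupNorm ht p))

/-- Existence of weighted least squares polynomials, with Pythagoras' theorem. -/
lemma exists_pythagoras (hw : ∀ t ∈ T, 0 < w t) (f : C(K, ℝ)) :
    ∃ q ∈ polySpace n K, ∀ p ∈ polySpace n K, ∑ t ∈ T, w t * (f t - p t) ^ 2 =
      ∑ t ∈ T, w t * (f t - q t) ^ 2 + ∑ t ∈ T, w t * (q t - p t) ^ 2 := by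
  -- Scaling by `√w` turns the problem into orthogonal projection onto the image of the polynomial
  -- space. `Φ` need not be injective on polynomials here, so uniqueness has to come from the
  -- norming property.
  let Φ : C(K, ℝ) →ₗ[ℝ] EuclideanSpace ℝ T :=
    { toFun := fun g => WithLp.toLp 2 fun t => √(w t) * g t
      map_add' := fun g g' => by ext t; simp [mul_add]
      map_smul' := fun r g => by ext t; simp; ring }
  have hΦ : ∀ g, ‖Φ g‖ ^ 2 = ∑ t ∈ T, w t * g t ^ 2 := by
    intro g
    rw [EuclideanSpace.norm_sq_eq, ← Finset.sum_coe_sort T]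
    refine Finset.sum_congr rfl fun t _ => ?_
    show ‖√(w t) * g t‖ ^ 2 = _
    rw [Real.norm_eq_abs, sq_abs, mul_pow, Real.sq_sqrt (hw t t.2).le]
  let U := (polySpace n K).map Φ
  obtain ⟨q, hq, hqe⟩ := Submodule.mem_map.mp (U.starProjection_apply_mem (Φ f))
  refine ⟨q, hq, fun p hp => ?_⟩
  have horth : inner ℝ (Φ (f - q)) (Φ (q - p)) = 0 := by
    rw [map_sub, hqe]
    exact U.starProjection_inner_eq_zero _ _
      (Submodule.mem_map_of_mem (Submodule.sub_mem _ hq hp))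
  have h1 := norm_add_sq_real (Φ (f - q)) (Φ (q - p))
  rw [horth, ← map_add, sub_add_sub_cancel, hΦ, hΦ, hΦ] at h1
  simpa using h1

/-- By Pythagoras, `q - p` is no larger than `f - p` in the weighted `ℓ²` norm, which is at most
`√(card A) ‖f - p‖`. Norming then gives `‖q - p‖ ≤ C‖f - p‖`, and the triangle inequality finishes.
Two minimizers have weighted distance zero, hence coincide. -/
lemma IsCatch.leastSquares [CompactSpace K] (h : IsCatch (2 * n) A T w) {c C : ℝ} (hc : 0 < c)
    (hA : ∀ p ∈ polySpace n K, ∃ y ∈ A, c * ‖p‖ ≤ |p y|) (hC : 0 ≤ C)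
    (hN : (A.card : ℝ) ≤ (c * C) ^ 2) (f : C(K, ℝ)) :
    (∃! q, IsWeightedLS n T w f q) ∧
      ∀ q, IsWeightedLS n T w f q → ‖f - q‖ ≤ (1 + C) * bestError n f := by
  obtain ⟨q, hq, hpyth⟩ := exists_pythagoras (n := n) h.pos f
  have hLS : IsWeightedLS n T w f q := by
    refine ⟨hq, fun p hp => ?_⟩
    rw [hpyth p hp]
    exact le_add_of_nonneg_right
      (Finset.sum_nonneg fun t ht => mul_nonneg (h.pos t ht).le (sq_nonneg _))
  have huniq : ∀ q', IsWeightedLS n T w f q' → q' = q := by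
    intro q' hq'
    have h1 := hq'.2 q hq
    rw [hpyth q' hq'.1] at h1
    have h2 := h.norm_sq_le hc hA (Submodule.sub_mem _ hq hq'.1)
    simp only [ContinuousMap.sub_apply] at h2
    have h3 : (c * ‖q - q'‖) ^ 2 ≤ 0 := by linarith
    have h4 : c * ‖q - q'‖ = 0 := pow_eq_zero_iff two_ne_zero |>.mp (le_antisymm h3 (sq_nonneg _))
    have h5 : ‖q - q'‖ = 0 := (mul_eq_zero.mp h4).resolve_left hc.ne'
    exact (sub_eq_zero.mp (norm_eq_zero.mp h5)).symm
  refine ⟨⟨q, hLS, huniq⟩, fun q' hq' => ?_⟩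
  rw [huniq q' hq']
  have hp : ∀ p ∈ polySpace n K, ‖f - q‖ ≤ (1 + C) * ‖f - p‖ := by
    intro p hp
    have h2 := h.norm_sq_le hc hA (Submodule.sub_mem _ hq hp)
    simp only [ContinuousMap.sub_apply] at h2
    have h3 := hpyth p hp
    have h4 : 0 ≤ ∑ t ∈ T, w t * (f t - q t) ^ 2 :=
      Finset.sum_nonneg fun t ht => mul_nonneg (h.pos t ht).le (sq_nonneg _)
    have h5 := h.sum_sq_le (f := f - p) (B := ‖f - p‖) fun t _ => (f - p).norm_coe_le_norm t
    simp only [ContinuousMap.sub_apply] at h5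
    have h6 : ‖q - p‖ ≤ C * ‖f - p‖ :=
      norm_le_of_sq_le hc (norm_nonneg _) (norm_nonneg _) hC hN (by linarith)
    have h7 : ‖f - q‖ ≤ ‖f - p‖ + ‖q - p‖ := by
      have := norm_sub_le (f - p) (q - p)
      rwa [sub_sub_sub_cancel_right] at this
    linarith
  rw [bestError, Real.mul_iInf_of_nonneg (by linarith)]
  exact le_ciInf fun p => hp p p.2

/-- Restriction maps the polynomials on `K` linearly onto those on `A`. -/
lemma finrank_polySpace_image_le (ν : ℕ) (A : Set K) :
    Module.finrank ℝ (polySpace ν (Subtype.val '' A : Set (EuclideanSpace ℝ (Fin d)))) ≤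
      Module.finrank ℝ (polySpace ν K) := by
  let r : C(K, ℝ) →ₗ[ℝ] C((Subtype.val '' A : Set (EuclideanSpace ℝ (Fin d))), ℝ) :=
    (ContinuousMap.compRightAlgHom ℝ ℝ
      (⟨Set.inclusion (Subtype.coe_image_subset K A), continuous_inclusion _⟩ :
        C((Subtype.val '' A : Set (EuclideanSpace ℝ (Fin d))), K))).toLinearMap
  have : polySpace ν (Subtype.val '' A : Set (EuclideanSpace ℝ (Fin d))) =
      (polySpace ν K).map r := by
    ext p
    rw [Submodule.mem_map, mem_polySpace]
    constructor
    · rintro ⟨P, hP, rfl⟩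
      refine ⟨_, mem_polySpace.mpr ⟨P, hP, rfl⟩, ?_⟩
      ext x
      rw [aeval_coordOn_apply]
      exact aeval_coordOn_apply P _
    · rintro ⟨q, hq, rfl⟩
      obtain ⟨P, hP, rfl⟩ := mem_polySpace.mp hq
      refine ⟨P, hP, ?_⟩
      ext x
      rw [aeval_coordOn_apply]
      exact (aeval_coordOn_apply P (Set.inclusion (Subtype.coe_image_subset K A) x)).symm
  rw [this]
  exact Submodule.finrank_map_le _ _

/-- Tchakaloff's theorem for finite sums of point evaluations. -/
lemma exists_isCatch (ν : ℕ) (hA : A.Nonempty) : ∃ T w, IsCatch ν A T w := by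
  classical
  set A' : Set (EuclideanSpace ℝ (Fin d)) := Subtype.val '' (A : Set K) with hA'
  let V := polySpace ν A'
  let ev : A' → Module.Dual ℝ V := fun x =>
    (ContinuousMap.evalAlgHom ℝ ℝ x).toLinearMap.comp V.subtype
  let pt : A → A' := fun x => ⟨x.1, x.1, x.2, rfl⟩
  let u : V := ⟨1, one_mem_polySpace⟩
  have hcard : (0 : ℝ) < A.card := by exact_mod_cast hA.card_pos
  -- The averaged sum over `A` is a convex combination of evaluations, so Caratheodory's theorem
  -- applies in the dual of the polynomial space on `A`.
  have hmem : ∑ x : A, (A.card : ℝ)⁻¹ • ev (pt x) ∈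
      convexHull ℝ (Set.range fun x : A => ev (pt x)) := by
    refine (convex_convexHull ℝ _).sum_mem (fun _ _ => by positivity) ?_
      fun x _ => subset_convexHull ℝ _ ⟨x, rfl⟩
    simp [hcard.ne']
  obtain ⟨ι, _, z, v, hz, hzind, hv, hv1, hsum⟩ := eq_pos_convex_span_of_mem_convexHull hmem
  have hzu : ∀ i, z i u = 1 := by
    intro i
    obtain ⟨x, hx⟩ := hz ⟨i, rfl⟩
    rw [← hx]
    rfl
  -- All evaluations equal 1 on the constant 1, so affine independence becomes linear independence.
  -- This gives at most `dim` points instead of `dim + 1`.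
  have hlin : LinearIndependent ℝ z := by
    rw [Fintype.linearIndependent_iff]
    intro g hg
    have hg0 : ∑ i, g i = 0 := by
      have := congrArg (fun L : Module.Dual ℝ V => L u) hg
      simpa [LinearMap.sum_apply, hzu] using this
    intro i
    refine affineIndependent_iff.mp hzind Finset.univ g hg0 hg i (Finset.mem_univ i)
  choose a ha using fun i => hz ⟨i, rfl⟩
  have hainj : Function.Injective (fun i => (a i : K)) := by
    intro i j hij
    apply hzind.injective
    rw [← ha i, ← ha j]
    have : a i = a j := Subtype.ext hij
    rw [this]
  refine ⟨Finset.univ.image fun i => (a i : K),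
    fun x => ∑ i, if (a i : K) = x then A.card * v i else 0, ?_, ?_, ?_, ?_⟩
  · intro x hx
    obtain ⟨i, _, rfl⟩ := Finset.mem_image.mp hx
    exact (a i).2
  · intro x hx
    obtain ⟨i, _, rfl⟩ := Finset.mem_image.mp hx
    refine Finset.sum_pos' (fun j _ => ?_) ⟨i, Finset.mem_univ i, ?_⟩
    · split_ifs
      · exact (mul_pos hcard (hv j)).le
      · exact le_rfl
    · rw [if_pos rfl]
      exact mul_pos hcard (hv i)
  · rw [Finset.card_image_of_injective _ hainj, Finset.card_univ]
    refine hlin.fintype_card_le_finrank.trans ?_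
    rw [Subspace.dual_finrank_eq]
  · intro p hp
    obtain ⟨P, hP, rfl⟩ := mem_polySpace.mp hp
    have h1 := congrArg (fun L : Module.Dual ℝ V => A.card * L
      ⟨MvPolynomial.aeval (coordOn A') P, mem_polySpace.mpr ⟨P, hP, rfl⟩⟩) hsum
    have hev : ∀ x : A, ev (pt x)
        ⟨MvPolynomial.aeval (coordOn A') P, mem_polySpace.mpr ⟨P, hP, rfl⟩⟩ =
        MvPolynomial.aeval (coordOn K) P x := by
      intro x
      rw [aeval_coordOn_apply]
      exact aeval_coordOn_apply P (pt x)
    simp only [LinearMap.sum_apply, LinearMap.smul_apply, ← ha, hev, smul_eq_mul] at h1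
    rw [← Finset.mul_sum, mul_inv_cancel_left₀ hcard.ne',
      Finset.sum_coe_sort A fun x => MvPolynomial.aeval (coordOn K) P x] at h1
    rw [← h1, Finset.sum_image fun i _ j _ h => hainj h, Finset.mul_sum]
    refine Finset.sum_congr rfl fun i _ => ?_
    have : ∀ j, ((a j : K) = a i) ↔ j = i := fun j => hainj.eq_iff
    simp only [this, Finset.sum_ite_eq', Finset.mem_univ, if_true]
    ring

end Catch

/-! ### The dimension of the polynomial spaces on the sphere -/

open MvPolynomial in
/-- The bivariate polynomials of total degree less than `N`. -/
noncomputable def bivariateLT (N : ℕ) : Submodule ℝ (MvPolynomial (Fin 2) ℝ) :=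
  restrictSupport ℝ {m : Fin 2 →₀ ℕ | m 0 + m 1 < N}

lemma mem_bivariateLT_of_totalDegree_lt {N : ℕ} {P : MvPolynomial (Fin 2) ℝ}
    (h : P.totalDegree < N) : P ∈ bivariateLT N := by
  rw [bivariateLT, MvPolynomial.mem_restrictSupport_iff]
  intro m hm
  have := (MvPolynomial.le_totalDegree hm).trans_lt h
  rw [Finsupp.sum_fintype _ _ (by simp)] at this
  simpa [Fin.sum_univ_two] using this

lemma totalDegree_lt_of_mem_bivariateLT {N : ℕ} {P : MvPolynomial (Fin 2) ℝ}
    (h : P ∈ bivariateLT N) (hP : P ≠ 0) : P.totalDegree < N := by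
  rw [bivariateLT, MvPolynomial.mem_restrictSupport_iff] at h
  have hb : ∀ m ∈ P.support, m 0 + m 1 < N := fun m hm => h hm
  have hN : 0 < N := by
    obtain ⟨m, hm⟩ := MvPolynomial.support_nonempty.mpr hP
    have := hb m hm
    omega
  rw [MvPolynomial.totalDegree, Finset.sup_lt_iff hN]
  intro m hm
  rw [Finsupp.sum_fintype _ _ (by simp)]
  simpa [Fin.sum_univ_two] using hb m hm

/-- Exponents of bivariate monomials, sorted by total degree. -/
noncomputable def bivariateExponents (N : ℕ) :
    (Σ k : Fin N, Fin (k + 1)) ≃ {m : Fin 2 →₀ ℕ | m 0 + m 1 < N} where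
  toFun x := ⟨Finsupp.equivFunOnFinite.symm ![x.2, x.1 - x.2], by
    have := x.1.2
    have := x.2.2
    simp
    omega⟩
  invFun m := ⟨⟨m.1 0 + m.1 1, m.2⟩, ⟨m.1 0, by simp⟩⟩
  left_inv := by
    rintro ⟨⟨k, hk⟩, ⟨i, hi⟩⟩
    have : i + (k - i) = k := by simp at hi; omega
    simp only [Sigma.mk.injEq]
    refine ⟨by simp [this], ?_⟩
    rw [Fin.heq_ext_iff (by simp [this])]
    simp
  right_inv := by
    rintro ⟨m, hm⟩
    ext i
    fin_cases i <;> simp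

lemma finrank_bivariateLT (N : ℕ) :
    Module.finrank ℝ (bivariateLT N) = ∑ k ∈ Finset.range N, (k + 1) := by
  rw [bivariateLT, Module.finrank_eq_nat_card_basis (MvPolynomial.basisRestrictSupport ℝ _),
    ← Nat.card_congr (bivariateExponents N), Nat.card_eq_fintype_card, Fintype.card_sigma]
  simp only [Fintype.card_fin]
  exact Fin.sum_univ_eq_sum_range (fun k => k + 1) N

instance (N : ℕ) : FiniteDimensional ℝ (bivariateLT N) :=
  Module.Finite.of_basis ((MvPolynomial.basisRestrictSupport ℝ
    {m : Fin 2 →₀ ℕ | m 0 + m 1 < N}).reindex (bivariateExponents N).symm)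

/-- Bivariate polynomials in the first two coordinates, as functions on the sphere. -/
noncomputable def sphereEval : MvPolynomial (Fin 2) ℝ →ₐ[ℝ] C(S2, ℝ) :=
  MvPolynomial.aeval fun i : Fin 2 => coordOn S2 i.castSucc

lemma sphereEval_apply (P : MvPolynomial (Fin 2) ℝ) (x : S2) :
    sphereEval P x =
      MvPolynomial.eval (fun i : Fin 2 => (x : EuclideanSpace ℝ (Fin 3)) i.castSucc) P := by
  have := MvPolynomial.comp_aeval_apply (fun i : Fin 2 => coordOn S2 i.castSucc)
    (ContinuousMap.evalAlgHom ℝ ℝ x) P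
  simp only [ContinuousMap.evalAlgHom_apply] at this
  rw [sphereEval, this, ← MvPolynomial.coe_aeval_eq_eval]
  rfl

lemma sphereEval_eq_aeval (P : MvPolynomial (Fin 2) ℝ) :
    sphereEval P = MvPolynomial.aeval (coordOn S2) (MvPolynomial.rename Fin.castSucc P) := by
  rw [MvPolynomial.aeval_rename]
  rfl

/-- The function `a(x, y) + z b(x, y)` on the sphere. -/
noncomputable def sphereDecomp (N : ℕ) : (bivariateLT (N + 1) × bivariateLT N) →ₗ[ℝ] C(S2, ℝ) :=
  (sphereEval.toLinearMap.comp (bivariateLT (N + 1)).subtype).coprod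
    ((LinearMap.mulLeft ℝ (coordOn S2 2)).comp
      (sphereEval.toLinearMap.comp (bivariateLT N).subtype))

lemma sphereDecomp_apply (N : ℕ) (a : bivariateLT (N + 1)) (b : bivariateLT N) :
    sphereDecomp N (a, b) = sphereEval a + coordOn S2 2 * sphereEval b := rfl

/-- Comparing values at `(x, y, z)` and `(x, y, -z)` separates `a` from `z b`. -/
lemma sphereDecomp_injective (N : ℕ) : Function.Injective (sphereDecomp N) := by
  rw [injective_iff_map_eq_zero]
  rintro ⟨⟨a, ha⟩, ⟨b, hb⟩⟩ h
  rw [sphereDecomp_apply] at h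
  simp only at h
  -- This square lies inside the open unit disc, so `z > 0` can be divided out; a product of
  -- infinite sets determines a polynomial.
  have key : ∀ u ∈ Set.pi .univ (fun _ : Fin 2 => Set.Icc (-(1 / 2) : ℝ) (1 / 2)),
      MvPolynomial.eval u a = 0 ∧ MvPolynomial.eval u b = 0 := by
    intro u hu
    have h0 := hu 0 trivial
    have h1 := hu 1 trivial
    simp only [Set.mem_Icc] at h0 h1
    have hpos : 0 < 1 - u 0 ^ 2 - u 1 ^ 2 := by nlinarith
    have hz : 0 < √(1 - u 0 ^ 2 - u 1 ^ 2) := Real.sqrt_pos.mpr hpos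
    have hz2 := Real.sq_sqrt hpos.le
    set z := √(1 - u 0 ^ 2 - u 1 ^ 2)
    have hmem : ∀ ε : ℝ, ε ^ 2 = 1 →
        (!₂[u 0, u 1, ε * z] : EuclideanSpace ℝ (Fin 3)) ∈ S2 := by
      intro ε hε
      rw [mem_sphere_zero_iff_norm, EuclideanSpace.norm_eq, Real.sqrt_eq_one]
      simp [Fin.sum_univ_three, mul_pow, hε, hz2]
    have hev : ∀ ε : ℝ, ε ^ 2 = 1 →
        MvPolynomial.eval u a + ε * z * MvPolynomial.eval u b = 0 := by
      intro ε hε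
      have h2 := congrArg (fun f : C(S2, ℝ) => f ⟨_, hmem ε hε⟩) h
      simp only [ContinuousMap.add_apply, ContinuousMap.mul_apply, sphereEval_apply,
        ContinuousMap.zero_apply] at h2
      have h3 : (fun i : Fin 2 => (!₂[u 0, u 1, ε * z] : EuclideanSpace ℝ (Fin 3)) i.castSucc)
          = u := by
        ext i
        fin_cases i <;> simp
      rw [h3] at h2
      exact h2
    have e1 := hev 1 (by norm_num)
    have e2 := hev (-1) (by norm_num)
    refine ⟨by linarith, ?_⟩
    have : z * MvPolynomial.eval u b = 0 := by linarith
    exact (mul_eq_zero.mp this).resolve_left hz.ne'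
  have hinf : ∀ _ : Fin 2, (Set.Icc (-(1 / 2) : ℝ) (1 / 2)).Infinite := fun _ =>
    Set.Icc_infinite (by norm_num)
  have ha0 : a = 0 := MvPolynomial.funext_set _ hinf fun u hu => by simpa using (key u hu).1
  have hb0 : b = 0 := MvPolynomial.funext_set _ hinf fun u hu => by simpa using (key u hu).2
  subst ha0 hb0
  rfl

lemma coordOn_two_sq : coordOn S2 2 ^ 2 =
    sphereEval (1 - MvPolynomial.X 0 ^ 2 - MvPolynomial.X 1 ^ 2) := by
  ext x
  rw [sphereEval_apply]
  have hx : ‖(x : EuclideanSpace ℝ (Fin 3))‖ ^ 2 = 1 := by simp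
  rw [EuclideanSpace.norm_sq_eq, Fin.sum_univ_three] at hx
  simp only [Real.norm_eq_abs, sq_abs] at hx
  simp [coordOn]
  linarith

/-- Replacing `z²` by `1 - x² - y²` does not raise the degree, and leaves at most one factor `z`.
That factor costs one degree, hence the strict bound on `b`. -/
lemma range_sphereDecomp (N : ℕ) : LinearMap.range (sphereDecomp N) = polySpace N S2 := by
  apply le_antisymm
  · rintro _ ⟨⟨⟨a, ha⟩, ⟨b, hb⟩⟩, rfl⟩
    rw [sphereDecomp_apply]
    refine Submodule.add_mem _ ?_ ?_
    · rcases eq_or_ne a 0 with rfl | h0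
      · simp
      have := totalDegree_lt_of_mem_bivariateLT ha h0
      rw [sphereEval_eq_aeval]
      exact mem_polySpace.mpr ⟨_,
        (MvPolynomial.totalDegree_rename_le _ _).trans (Nat.le_of_lt_succ this), rfl⟩
    · rcases eq_or_ne b 0 with rfl | h0
      · simp
      have h1 := totalDegree_lt_of_mem_bivariateLT hb h0
      have h2 := MvPolynomial.totalDegree_rename_le (Fin.castSucc : Fin 2 → Fin 3) b
      rw [sphereEval_eq_aeval]
      refine mem_polySpace.mpr ⟨MvPolynomial.X 2 * MvPolynomial.rename Fin.castSucc b,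
        (MvPolynomial.totalDegree_mul _ _).trans ?_, by simp⟩
      rw [MvPolynomial.totalDegree_X]
      omega
  · intro p hp
    obtain ⟨P, hP, rfl⟩ := mem_polySpace.mp hp
    rw [P.as_sum, map_sum]
    refine Submodule.sum_mem _ fun e he => ?_
    have hen : e 0 + e 1 + e 2 ≤ N := by
      have := (MvPolynomial.le_totalDegree he).trans hP
      rw [Finsupp.sum_fintype _ _ (by simp)] at this
      simpa [Fin.sum_univ_three] using this
    set R : MvPolynomial (Fin 2) ℝ := MvPolynomial.C (P.coeff e) * (MvPolynomial.X 0 ^ e 0 *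
      MvPolynomial.X 1 ^ e 1 *
        (1 - MvPolynomial.X 0 ^ 2 - MvPolynomial.X 1 ^ 2) ^ (e 2 / 2)) with hR
    have hRdeg : R.totalDegree ≤ e 0 + e 1 + 2 * (e 2 / 2) := by
      have h1 : ∀ (i : Fin 2) (j : ℕ),
          (MvPolynomial.X i ^ j : MvPolynomial (Fin 2) ℝ).totalDegree ≤ j := fun i j => by simp
      have h2 : (1 - MvPolynomial.X 0 ^ 2 - MvPolynomial.X 1 ^ 2 :
          MvPolynomial (Fin 2) ℝ).totalDegree ≤ 2 := by
        refine (MvPolynomial.totalDegree_sub _ _).trans (max_le ?_ (h1 _ _))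
        refine (MvPolynomial.totalDegree_sub _ _).trans (max_le (by simp) (h1 _ _))
      have h3 := (MvPolynomial.totalDegree_pow (1 - MvPolynomial.X 0 ^ 2 - MvPolynomial.X 1 ^ 2 :
        MvPolynomial (Fin 2) ℝ) (e 2 / 2)).trans (Nat.mul_le_mul_left _ h2)
      refine (MvPolynomial.totalDegree_mul _ _).trans ?_
      rw [MvPolynomial.totalDegree_C, zero_add]
      refine (MvPolynomial.totalDegree_mul _ _).trans ?_
      have h4 := MvPolynomial.totalDegree_mul (MvPolynomial.X 0 ^ e 0 : MvPolynomial (Fin 2) ℝ)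
        (MvPolynomial.X 1 ^ e 1)
      have h5 := h1 0 (e 0)
      have h6 := h1 1 (e 1)
      omega
    have hval : MvPolynomial.aeval (coordOn S2) (MvPolynomial.monomial e (P.coeff e)) =
        coordOn S2 2 ^ (e 2 % 2) * sphereEval R := by
      rw [hR, map_mul, map_mul, map_mul, map_pow, map_pow, map_pow, ← coordOn_two_sq, ← pow_mul,
        MvPolynomial.aeval_monomial, Finsupp.prod_fintype _ _ (by simp), Fin.prod_univ_three]
      have h1 : coordOn S2 2 ^ e 2 =
          coordOn S2 2 ^ (2 * (e 2 / 2)) * coordOn S2 2 ^ (e 2 % 2) := by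
        rw [← pow_add, Nat.div_add_mod]
      have h2 : sphereEval (MvPolynomial.X 0) = coordOn S2 0 := by simp [sphereEval]
      have h3 : sphereEval (MvPolynomial.X 1) = coordOn S2 1 := by simp [sphereEval]
      have h4 : sphereEval (MvPolynomial.C (P.coeff e)) = algebraMap ℝ _ (P.coeff e) := by
        simp [sphereEval]
      rw [h1, h2, h3, h4]
      ring
    rw [hval]
    rcases Nat.mod_two_eq_zero_or_one (e 2) with h | h
    · refine ⟨(⟨R, mem_bivariateLT_of_totalDegree_lt (by omega)⟩, 0), ?_⟩
      rw [sphereDecomp_apply, h]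
      simp
    · refine ⟨(0, ⟨R, mem_bivariateLT_of_totalDegree_lt (by omega)⟩), ?_⟩
      rw [sphereDecomp_apply, h]
      simp

/-- The polynomials of degree at most `N` on the sphere form a space of dimension `(N + 1)²`. -/
lemma finrank_polySpace_S2 (N : ℕ) : Module.finrank ℝ (polySpace N S2) = (N + 1) ^ 2 := by
  rw [← range_sphereDecomp, LinearMap.finrank_range_of_inj (sphereDecomp_injective N),
    Module.finrank_prod, finrank_bivariateLT, finrank_bivariateLT]
  induction N with
  | zero => simp
  | succ N ih =>
    rw [Finset.sum_range_succ _ (N + 1), Finset.sum_range_succ _ N] at *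
    nlinarith

/-! ### Meshes with explicit constants, good coverings -/

lemma card_le_of_isCatch {n : ℕ} {A T : Finset S2} {w : S2 → ℝ} (h : IsCatch (2 * n) A T w) :
    T.card ≤ (2 * n + 1) ^ 2 :=
  h.card_le.trans ((finrank_polySpace_image_le _ _).trans (finrank_polySpace_S2 _).le)

/-- Catch sets extracted from norming sets of controlled cardinality are weakly admissible
meshes, with near optimal weighted least squares. -/
theorem catch_mesh_properties {A : ℕ → Finset S2} {C : ℕ → ℝ}
    (hA : ∀ n, 1 ≤ n → ∃ c > 0, (∀ p ∈ polySpace n S2, ∃ y ∈ A n, c * ‖p‖ ≤ |p y|) ∧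
      0 ≤ C n ∧ ((A n).card : ℝ) ≤ (c * C n) ^ 2)
    (hC : C =O[atTop] (fun n : ℕ => (n : ℝ))) :
    (∀ n : ℕ, 1 ≤ n → ∃ (T : Finset S2) (w : S2 → ℝ), IsCatch (2 * n) (A n) T w) ∧
    (∀ (T : ℕ → Finset S2) (w : ℕ → S2 → ℝ),
      (∀ n : ℕ, 1 ≤ n → IsCatch (2 * n) (A n) (T n) (w n)) →
        IsWeaklyAdmissibleMesh S2 T C ∧
        ∀ n : ℕ, 1 ≤ n → (T n).card ≤ (2 * n + 1) ^ 2 ∧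
          ∀ f : C(S2, ℝ), (∃! q, IsWeightedLS n (T n) (w n) f q) ∧
            ∀ q, IsWeightedLS n (T n) (w n) f q → ‖f - q‖ ≤ (1 + C n) * bestError n f) := by
  refine ⟨fun n hn => ?_, fun T w hT => ⟨⟨?_, ?_, ?_⟩, fun n hn => ⟨card_le_of_isCatch (hT n hn),
    fun f => ?_⟩⟩⟩
  · obtain ⟨c, _, hy, _⟩ := hA n hn
    -- The zero polynomial serves only to show that `A n` is nonempty.
    obtain ⟨y, hy, _⟩ := hy 0 (Submodule.zero_mem _)
    exact exists_isCatch _ ⟨y, hy⟩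
  · intro n hn p hp
    obtain ⟨c, hc, hy, hC0, hcard⟩ := hA n hn
    exact (hT n hn).norming hc hy hC0 hcard hp
  -- Here `(2n + 1)² ≤ 4 (n + 1)²`, so `β = 1` suffices.
  · refine ⟨1, le_rfl, IsBigO.of_bound 4 ?_⟩
    filter_upwards [eventually_ge_atTop 1] with n hn
    have h1 : ((T n).card : ℝ) ≤ (2 * n + 1) ^ 2 := by
      exact_mod_cast card_le_of_isCatch (hT n hn)
    rw [finrank_polySpace_S2, Real.rpow_one, Real.norm_natCast, Real.norm_natCast]
    push_cast
    have := Nat.cast_nonneg (α := ℝ) n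
    nlinarith
  · refine ⟨1, zero_le_one, ?_⟩
    simpa using hC
  · obtain ⟨c, hc, hy, hC0, hcard⟩ := hA n hn
    exact (hT n hn).leastSquares hc hy hC0 hcard f

lemma norming_of_covering {n : ℕ} (hn : 1 ≤ n) {A : Finset S2} {t : ℝ} (ht0 : 0 ≤ t) (ht1 : t ≤ 1)
    (h : ∀ x : S2, ∃ y ∈ A, dist x y ≤ t / n * (1 - t / n / (2 * Real.pi)))
    {p : C(S2, ℝ)} (hp : p ∈ polySpace n S2) : ∃ y ∈ A, (1 - t ^ 2 / 2) * ‖p‖ ≤ |p y| := by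
  obtain ⟨x, hx⟩ := exists_abs_eq_norm p
  obtain ⟨y, hy, hxy⟩ := h x
  have hn' : (1 : ℝ) ≤ n := by exact_mod_cast hn
  refine ⟨y, hy, ?_⟩
  have := lower_bound_of_dist_le hn hp hx (t := t / n) (by positivity)
    ((div_le_one (by linarith)).mpr (by linarith)) hxy
  rw [mul_div_cancel₀ _ (by linarith)] at this
  linarith

/-! ### Good coverings -/

lemma IsGoodCovering.exists_dist_le {X : ℕ → Finset S2} {α : ℝ} (h : IsGoodCovering X α) {M : ℕ}
    (hM : 2 ≤ M) (x : S2) : ∃ y ∈ X M, dist x y ≤ α / √(M : ℝ) := by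
  obtain ⟨h1, h2⟩ := h M hM
  have hne : (X M : Set S2).Nonempty := by
    rw [Finset.coe_nonempty, ← Finset.card_pos]; omega
  obtain ⟨y, hy, hxy⟩ := (X M).finite_toSet.isCompact.exists_infDist_eq_dist hne x
  refine ⟨y, hy, ?_⟩
  rw [← hxy]
  exact (le_ciSup (f := fun x : S2 => Metric.infDist x (X M : Set S2))
    (isCompact_range (Metric.continuous_infDist_pt _)).bddAbove x).trans h2

lemma exists_orthogonal_S2 (u v : EuclideanSpace ℝ (Fin 3)) :
    ∃ w : S2, inner ℝ u (w : EuclideanSpace ℝ (Fin 3)) = 0 ∧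
      inner ℝ v (w : EuclideanSpace ℝ (Fin 3)) = 0 := by
  have hker := LinearMap.ker_ne_bot_of_finrank_lt
    (f := ((innerₛₗ ℝ u).prod (innerₛₗ ℝ v) : EuclideanSpace ℝ (Fin 3) →ₗ[ℝ] ℝ × ℝ)) (by simp)
  obtain ⟨z, hz, hz0⟩ := Submodule.exists_mem_ne_zero_of_ne_bot hker
  replace hz : inner ℝ u z = 0 ∧ inner ℝ v z = 0 := Prod.mk_eq_zero.mp hz
  refine ⟨⟨‖z‖⁻¹ • z, ?_⟩, ?_, ?_⟩
  · rw [mem_sphere_zero_iff_norm, norm_smul, norm_inv, norm_norm,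
      inv_mul_cancel₀ (norm_ne_zero_iff.mpr hz0)]
  · rw [inner_smul_right, hz.1, mul_zero]
  · rw [inner_smul_right, hz.2, mul_zero]

/-- A unit vector orthogonal to both points of `X 2` is at distance `√2` from each, so `√2 ≤ α/√2`.
This keeps `M_n` large enough to absorb the ceiling. -/
lemma IsGoodCovering.two_le {X : ℕ → Finset S2} {α : ℝ} (h : IsGoodCovering X α) : 2 ≤ α := by
  classical
  obtain ⟨u, v, _, huv⟩ := Finset.card_eq_two.mp (h 2 le_rfl).1
  obtain ⟨w, hu, hv⟩ := exists_orthogonal_S2 u v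
  obtain ⟨y, hy, hd⟩ := h.exists_dist_le le_rfl w
  have hin : inner ℝ (w : EuclideanSpace ℝ (Fin 3)) y = 0 := by
    rw [huv, Finset.mem_insert, Finset.mem_singleton] at hy
    rw [real_inner_comm]
    rcases hy with rfl | rfl <;> assumption
  have hd2 : dist w y ^ 2 = 2 := by
    rw [Subtype.dist_eq, dist_eq_norm, norm_sub_sq_real, hin]
    simp
    norm_num
  have h2 : √((2 : ℕ) : ℝ) = dist w y := by
    rw [← Real.sqrt_sq (dist_nonneg (x := w) (y := y)), hd2]; norm_num
  rw [h2] at hd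
  have hpos : 0 < dist w y := by
    rw [← h2]; positivity
  rw [le_div_iff₀ hpos] at hd
  nlinarith

lemma tendsto_const_div_natCast (a : ℝ) : Tendsto (fun n : ℕ => a / (n : ℝ)) atTop (nhds 0) :=
  tendsto_const_nhds.div_atTop tendsto_natCast_atTop_atTop

lemma sigma_isEquivalent {α θ : ℝ} (hα : 0 < α) (hθ0 : 0 < θ) :
    (fun n : ℕ => sigma α θ n * n / (1 - θ)) ~[atTop]
      (fun n : ℕ => α * n / (θ * (1 - θ))) := by
  have h1 : Tendsto (fun n : ℕ => sigma α θ n) atTop (nhds (α / θ)) := by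
    have h2 := ((tendsto_const_div_natCast θ).const_sub (2 * Real.pi)).const_mul θ
    have h3 := (tendsto_const_nhds (x := 2 * Real.pi * α)).div h2
      (by rw [sub_zero]; positivity)
    rw [sub_zero, mul_comm θ, mul_div_mul_left _ _ (by positivity)] at h3
    exact h3
  have h2 : (fun n : ℕ => sigma α θ n) ~[atTop] fun _ => α / θ :=
    (isEquivalent_const_iff_tendsto (by positivity)).mpr h1
  have h3 := h2.mul (IsEquivalent.refl (u := fun n : ℕ => (n : ℝ) / (1 - θ)))
  convert h3 using 1 <;> ext n <;> simp only [Pi.mul_apply]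
  · ring
  · rw [div_mul_div_comm]

/-- `σ_n` is chosen so that `α/(σ_n n)` is exactly the admissible chord length for angle `θ/n`. Thus
`c = 1 - θ²/2` is available where the constant asks only for `1 - θ`. -/
theorem goodCovering_norming {X : ℕ → Finset S2} {α θ : ℝ} (hX : IsGoodCovering X α)
    (hθ0 : 0 < θ) (hθ1 : θ < 1) {n : ℕ} (hn : 1 ≤ n) :
    ∃ c > 0, (∀ p ∈ polySpace n S2, ∃ y ∈ X (meshSize α θ n), c * ‖p‖ ≤ |p y|) ∧
      0 ≤ sigma α θ n * n / (1 - θ) ∧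
      ((X (meshSize α θ n)).card : ℝ) ≤ (c * (sigma α θ n * n / (1 - θ))) ^ 2 := by
  have hα := hX.two_le
  have hpi := Real.pi_gt_three
  have hn' : (1 : ℝ) ≤ n := by exact_mod_cast hn
  have hθn0 : 0 < θ / n := by positivity
  have hθn : θ / n ≤ 1 := (div_le_one (by linarith)).mpr (by linarith)
  set S := sigma α θ n * n with hSdef
  have hS : S = α * n / (θ * (1 - θ / n / (2 * Real.pi))) := by
    rw [hSdef, sigma]
    have : 2 * Real.pi - θ / n = 2 * Real.pi * (1 - θ / n / (2 * Real.pi)) := by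
      field_simp
    rw [this]
    field_simp
  have hr0 : 0 < 1 - θ / n / (2 * Real.pi) := by
    have : θ / n / (2 * Real.pi) < 1 := by
      rw [div_lt_one (by positivity)]; linarith
    linarith
  have hr1 : 1 - θ / n / (2 * Real.pi) ≤ 1 := by
    have : 0 < θ / n / (2 * Real.pi) := by positivity
    linarith
  have hθS : 2 ≤ θ * S := by
    rw [hS, mul_div_assoc', le_div_iff₀ (by positivity)]
    nlinarith [mul_le_mul hα hn' zero_le_one (by linarith)]
  have hS2 : 2 < S := by nlinarith
  have hM : S ^ 2 ≤ (meshSize α θ n : ℝ) := by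
    rw [meshSize, ← mul_pow]
    exact Nat.le_ceil _
  have hM' : (meshSize α θ n : ℝ) ≤ S ^ 2 + 1 := by
    rw [meshSize, ← mul_pow]
    exact (Nat.ceil_lt_add_one (sq_nonneg _)).le
  have hM2 : 2 ≤ meshSize α θ n := by
    have : (2 : ℝ) ≤ meshSize α θ n := by nlinarith
    exact_mod_cast this
  refine ⟨1 - θ ^ 2 / 2, by nlinarith, fun p hp => norming_of_covering hn hθ0.le hθ1.le
    (fun x => ?_) hp, div_nonneg (by linarith) (by linarith), ?_⟩
  · obtain ⟨y, hy, hd⟩ := hX.exists_dist_le hM2 x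
    refine ⟨y, hy, hd.trans ?_⟩
    have h1 : S ≤ √(meshSize α θ n : ℝ) := Real.le_sqrt_of_sq_le hM
    calc α / √(meshSize α θ n : ℝ) ≤ α / S := by gcongr
      _ = _ := by rw [hS]; field_simp
  · rw [(hX _ hM2).1]
    refine hM'.trans ?_
    rw [mul_div_assoc', div_pow, le_div_iff₀ (by nlinarith)]
    -- The goal is `(1-θ)²(S² + 1) ≤ c²S²`, and `c² - (1-θ)² = θ(1 - θ/2)(2 - θ - θ²/2)`. Times `S²`
    -- this is at least `4 · 1/4 ≥ (1-θ)²`.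
    have h1 : 4 ≤ θ * S ^ 2 := by nlinarith
    have h2 : (1 : ℝ) / 4 ≤ (1 - θ / 2) * (2 - θ - θ ^ 2 / 2) := by
      have := mul_le_mul (show (1 : ℝ) / 2 ≤ 1 - θ / 2 by linarith)
        (show (1 : ℝ) / 2 ≤ 2 - θ - θ ^ 2 / 2 by nlinarith) (by norm_num) (by linarith)
      linarith
    have h3 : (1 - θ) ^ 2 ≤ 1 := by nlinarith
    nlinarith [mul_le_mul h1 h2 (by norm_num) (by positivity)]

/-! ### Zonal equal area configurations -/

/-- Chord at most arc, from `1 - x²/2 ≤ cos x`. -/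
lemma dist_spherePoint_meridian_le (a c l : ℝ) :
    dist (spherePoint a l) (spherePoint c l) ≤ |a - c| := by
  rw [Subtype.dist_eq, EuclideanSpace.dist_eq, ← Real.sqrt_sq_eq_abs]
  apply Real.sqrt_le_sqrt
  simp only [spherePoint, Fin.sum_univ_three, Real.dist_eq, sq_abs]
  have h1 := Real.one_sub_sq_div_two_le_cos (x := a - c)
  rw [Real.cos_sub] at h1
  have h2 := Real.sin_sq_add_cos_sq l
  have h3 := Real.sin_sq_add_cos_sq a
  have h4 := Real.sin_sq_add_cos_sq c
  have : (Real.sin a * Real.cos l - Real.sin c * Real.cos l) ^ 2 +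
      (Real.sin a * Real.sin l - Real.sin c * Real.sin l) ^ 2 +
      (Real.cos a - Real.cos c) ^ 2 =
      2 - 2 * (Real.cos a * Real.cos c + Real.sin a * Real.sin c) := by
    linear_combination (Real.sin a - Real.sin c) ^ 2 * h2 + h3 + h4
  simp
  rw [this]
  linarith

lemma dist_spherePoint_parallel_le (c l l' : ℝ) (hc : 0 ≤ Real.sin c) :
    dist (spherePoint c l) (spherePoint c l') ≤ Real.sin c * |l - l'| := by
  have h0 : Real.sin c * |l - l'| = √((Real.sin c * (l - l')) ^ 2) := by
    rw [Real.sqrt_sq_eq_abs, abs_mul, abs_of_nonneg hc]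
  rw [Subtype.dist_eq, EuclideanSpace.dist_eq, h0]
  apply Real.sqrt_le_sqrt
  simp only [spherePoint, Fin.sum_univ_three, Real.dist_eq, sq_abs]
  have h1 := Real.one_sub_sq_div_two_le_cos (x := l - l')
  rw [Real.cos_sub] at h1
  have h2 := Real.sin_sq_add_cos_sq l
  have h3 := Real.sin_sq_add_cos_sq l'
  have : (Real.sin c * Real.cos l - Real.sin c * Real.cos l') ^ 2 +
      (Real.sin c * Real.sin l - Real.sin c * Real.sin l') ^ 2 =
      Real.sin c ^ 2 * (2 - 2 * (Real.cos l * Real.cos l' + Real.sin l * Real.sin l')) := by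
    linear_combination Real.sin c ^ 2 * (h2 + h3)
  simp
  rw [this, mul_pow]
  exact mul_le_mul_of_nonneg_left (by linarith) (sq_nonneg _)

lemma exists_spherePoint_eq (x : S2) :
    ∃ a l : ℝ, 0 ≤ a ∧ a ≤ Real.pi ∧ x = spherePoint a l := by
  obtain ⟨x, hx⟩ := x
  have hn : ‖x‖ ^ 2 = 1 := by
    rw [mem_sphere_zero_iff_norm] at hx
    rw [hx]; norm_num
  rw [EuclideanSpace.norm_sq_eq, Fin.sum_univ_three] at hn
  simp only [Real.norm_eq_abs, sq_abs] at hn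
  have h2 : |x 2| ≤ 1 := by
    rw [← sq_le_one_iff_abs_le_one]; nlinarith [sq_nonneg (x 0), sq_nonneg (x 1)]
  obtain ⟨h2a, h2b⟩ := abs_le.mp h2
  set z : ℂ := ⟨x 0, x 1⟩ with hz
  have hs : Real.sin (Real.arccos (x 2)) = ‖z‖ := by
    rw [Real.sin_arccos, Complex.norm_def, Complex.normSq_apply]
    congr 1
    simp only [hz]
    linarith
  refine ⟨Real.arccos (x 2), z.arg, Real.arccos_nonneg _, Real.arccos_le_pi _, ?_⟩
  ext i
  fin_cases i
  · simp [spherePoint, hs, hz]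
  · simp [spherePoint, hs, hz]
  · simp [spherePoint, Real.cos_arccos h2a h2b]

lemma spherePoint_add_int_mul_two_pi (c l : ℝ) (j : ℤ) :
    spherePoint c (l + j * (2 * Real.pi)) = spherePoint c l := by
  simp [spherePoint, Real.cos_add_int_mul_two_pi, Real.sin_add_int_mul_two_pi]

/-- Among `m` equally spaced longitudes one is within `π / m` of a given one. -/
lemma exists_sector (c l ψ : ℝ) {m : ℕ} (hm : 0 < m) (hc : 0 ≤ Real.sin c) :
    ∃ k < m, dist (spherePoint c l) (spherePoint c (ψ + 2 * Real.pi * k / m)) ≤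
      Real.sin c * (Real.pi / m) := by
  have hmR : (0 : ℝ) < m := by exact_mod_cast hm
  have hmZ : (0 : ℤ) < m := by exact_mod_cast hm
  have hpi := Real.pi_pos
  -- Index of the nearest sector centre, reduced modulo `m`; the quotient only adds full turns.
  set r : ℤ := round ((l - ψ) * m / (2 * Real.pi)) with hr
  have hround := abs_sub_round ((l - ψ) * m / (2 * Real.pi))
  rw [← hr] at hround
  have hk0 : 0 ≤ r % m := Int.emod_nonneg _ hmZ.ne'
  have hkm : r % m < m := Int.emod_lt_of_pos _ hmZ
  refine ⟨(r % m).toNat, by omega, ?_⟩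
  have hcast : (((r % m).toNat : ℕ) : ℝ) = ((r % m : ℤ) : ℝ) := by
    exact_mod_cast congrArg (Int.cast (R := ℝ)) (Int.toNat_of_nonneg hk0)
  have hdm : (r : ℝ) = (m : ℝ) * ((r / m : ℤ) : ℝ) + ((r % m : ℤ) : ℝ) := by
    exact_mod_cast (Int.mul_ediv_add_emod r m).symm
  rw [← spherePoint_add_int_mul_two_pi c (ψ + _) (r / m)]
  refine (dist_spherePoint_parallel_le c _ _ hc).trans (mul_le_mul_of_nonneg_left ?_ hc)
  have e : l - (ψ + 2 * Real.pi * ((r % m).toNat : ℕ) / m + ((r / m : ℤ) : ℝ) * (2 * Real.pi)) =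
      ((l - ψ) * m / (2 * Real.pi) - r) * (2 * Real.pi / m) := by
    rw [hcast, hdm]
    field_simp
    ring
  rw [e, abs_mul, abs_of_pos (show 0 < 2 * Real.pi / m by positivity)]
  calc _ ≤ 1 / 2 * (2 * Real.pi / m) := by gcongr
    _ = _ := by ring

/-! ### Cap areas and sine estimates -/

/-- Caps have area proportional to `sin²(a/2)`, so this expresses the area of a collar through its
middle colatitude and half its height. -/
lemma sin_sq_half_sub (u v : ℝ) : Real.sin (u / 2) ^ 2 - Real.sin (v / 2) ^ 2 =
    Real.sin ((u + v) / 2) * Real.sin ((u - v) / 2) := by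
  have e1 : (u + v) / 2 = u / 2 + v / 2 := by ring
  have e2 : (u - v) / 2 = u / 2 - v / 2 := by ring
  rw [e1, e2, Real.sin_add, Real.sin_sub]
  have h1 := Real.sin_sq_add_cos_sq (u / 2)
  have h2 := Real.sin_sq_add_cos_sq (v / 2)
  linear_combination Real.sin (v / 2) ^ 2 * h1 - Real.sin (u / 2) ^ 2 * h2

lemma sin_le_sin_of_mem {a u : ℝ} (ha : 0 ≤ a) (h1 : a ≤ u) (h2 : u ≤ Real.pi - a) :
    Real.sin a ≤ Real.sin u := by
  rcases le_total u (Real.pi / 2) with h | h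
  · exact Real.sin_le_sin_of_le_of_le_pi_div_two (by linarith [Real.pi_pos]) h h1
  · rw [← Real.sin_pi_sub u]
    exact Real.sin_le_sin_of_le_of_le_pi_div_two (by linarith [Real.pi_pos]) (by linarith)
      (by linarith)

lemma mul_le_sin_of_sq_le {u b : ℝ} (hu : 0 ≤ u) (hb : u ^ 2 ≤ 6 * b) :
    (1 - b) * u ≤ Real.sin u := by
  rcases hu.eq_or_lt with rfl | h
  · simp
  have := Real.sin_gt_sub_cube h
  nlinarith

lemma sin_sq_half_le_iff {u v : ℝ} (hu0 : 0 ≤ u) (hu : u ≤ Real.pi) (hv0 : 0 ≤ v)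
    (hv : v ≤ Real.pi) : Real.sin (u / 2) ^ 2 ≤ Real.sin (v / 2) ^ 2 ↔ u ≤ v := by
  rw [sq_le_sq₀ (Real.sin_nonneg_of_nonneg_of_le_pi (by linarith) (by linarith))
    (Real.sin_nonneg_of_nonneg_of_le_pi (by linarith) (by linarith)),
    Real.strictMonoOn_sin.le_iff_le ⟨by linarith, by linarith⟩ ⟨by linarith, by linarith⟩]
  constructor <;> intro h <;> linarith

/-- The common height of the ideal collars. -/
noncomputable def idealHeight (N : ℕ) : ℝ := (Real.pi - 2 * eqPolarAngle N) / eqNumCollars N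

/-- The colatitude of the lower boundary of an ideal collar. -/
noncomputable def idealAngle (N i : ℕ) : ℝ := eqPolarAngle N + i * idealHeight N

section Zonal

variable {N : ℕ}

/-! ### Collar geometry in units of `1/√N` -/

lemma inv_sqrt_bounds (hN : 40 ≤ N) :
    0 < 1 / √(N : ℝ) ∧ (1 / √(N : ℝ)) ^ 2 * N = 1 ∧ (1 / √(N : ℝ)) ^ 2 ≤ 1 / 40 ∧
      1 / √(N : ℝ) ≤ 0.1582 := by
  have hNR : (40 : ℝ) ≤ N := by exact_mod_cast hN
  have h0 : 0 < √(N : ℝ) := Real.sqrt_pos.mpr (by linarith)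
  have h1 : (1 / √(N : ℝ)) ^ 2 = 1 / N := by
    rw [div_pow, Real.sq_sqrt (by linarith)]; simp
  have h2 : (1 / √(N : ℝ)) ^ 2 ≤ 1 / 40 := by
    rw [h1]; exact div_le_div_of_nonneg_left (by norm_num) (by norm_num) hNR
  refine ⟨by positivity, by rw [h1]; field_simp, h2, ?_⟩
  exact abs_le_of_sq_le_sq' (by linarith [show (0.1582 : ℝ) ^ 2 ≥ 1 / 40 by norm_num])
    (by norm_num) |>.2

lemma eqPolarAngle_bounds (hN : 40 ≤ N) :
    2 * (1 / √(N : ℝ)) ≤ eqPolarAngle N ∧ eqPolarAngle N ≤ 2.02 * (1 / √(N : ℝ)) := by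
  obtain ⟨h0, -, h2, h3⟩ := inv_sqrt_bounds hN
  rw [eqPolarAngle]
  set s := 1 / √(N : ℝ)
  have hpi := Real.pi_gt_three
  constructor
  · have := (Real.le_arcsin_iff_sin_le' (x := s) (y := s)
      ⟨by linarith, by linarith⟩).mpr (Real.sin_le h0.le)
    linarith
  · have h4 := mul_le_sin_of_sq_le (u := 1.01 * s) (b := 0.005) (by linarith) (by nlinarith)
    have := (Real.arcsin_le_iff_le_sin' (x := s) (y := 1.01 * s)
      ⟨by linarith, by linarith⟩).mpr (by linarith)
    linarith

lemma sin_half_eqPolarAngle_sq (hN : 40 ≤ N) : N * Real.sin (eqPolarAngle N / 2) ^ 2 = 1 := by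
  obtain ⟨h0, h1, h2, h3⟩ := inv_sqrt_bounds hN
  rw [eqPolarAngle, mul_div_cancel_left₀ _ two_ne_zero,
    Real.sin_arcsin (by linarith) (by linarith)]
  linarith

/-- The ideal number of collars `x` is at least 4, so `x / round x` lies in `[7/8, 9/8]`. The height
is this ratio times `2√π/√N`. -/
lemma eqNumCollars_bounds (hN : 40 ≤ N) : 0 < eqNumCollars N ∧
    3.09 * (1 / √(N : ℝ)) ≤ idealHeight N ∧ idealHeight N ≤ 4.01 * (1 / √(N : ℝ)) := by
  obtain ⟨h0, -, h2, h3⟩ := inv_sqrt_bounds hN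
  obtain ⟨ha, hb⟩ := eqPolarAngle_bounds hN
  have hNR : (40 : ℝ) ≤ N := by exact_mod_cast hN
  have hpi := Real.pi_gt_d2
  have hpi' := Real.pi_lt_d2
  have hsqrt : √(4 * Real.pi / N) = 2 * √Real.pi * (1 / √(N : ℝ)) := by
    rw [Real.sqrt_div (by positivity), Real.sqrt_mul (by norm_num),
      show (4 : ℝ) = 2 ^ 2 by norm_num, Real.sqrt_sq (by norm_num)]
    ring
  have hp1 : 1.77 ≤ √Real.pi := Real.le_sqrt_of_sq_le (by norm_num; linarith)
  have hp2 : √Real.pi ≤ 1.78 := by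
    rw [Real.sqrt_le_left (by norm_num)]; norm_num; linarith
  set s := 1 / √(N : ℝ)
  set x := (Real.pi - 2 * eqPolarAngle N) / √(4 * Real.pi / N) with hx
  set h := √(4 * Real.pi / N) with hh
  have hh0 : 3.54 * s ≤ h := by rw [hsqrt]; nlinarith
  have hh1 : h ≤ 3.56 * s := by rw [hsqrt]; nlinarith
  have hhpos : 0 < h := by linarith
  have hx0 : 4 ≤ x := by
    rw [hx, le_div_iff₀ hhpos]
    nlinarith
  have hround := abs_le.mp (abs_sub_round x)
  have hr4 : 4 ≤ round x := by
    have : (3 : ℝ) < round x := by linarith [hround.2]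
    have : 3 < round x := by exact_mod_cast this
    omega
  have hk : (eqNumCollars N : ℤ) = round x := by
    rw [eqNumCollars, if_neg (by omega), ← hh, ← hx]
    omega
  have hkR : (eqNumCollars N : ℝ) = round x := by exact_mod_cast congrArg (Int.cast (R := ℝ)) hk
  have hr4R : (4 : ℝ) ≤ round x := by exact_mod_cast hr4
  have hxh : Real.pi - 2 * eqPolarAngle N = x * h := by rw [hx, div_mul_cancel₀ _ hhpos.ne']
  refine ⟨by omega, ?_, ?_⟩
  · rw [idealHeight, hkR, hxh, le_div_iff₀ (by linarith)]
    nlinarith [mul_le_mul_of_nonneg_left hh0 (show 0 ≤ x by linarith)]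
  · rw [idealHeight, hkR, hxh, div_le_iff₀ (by linarith)]
    nlinarith [mul_le_mul_of_nonneg_left hh1 (show 0 ≤ x by linarith)]

lemma idealAngle_numCollars (hN : 40 ≤ N) :
    idealAngle N (eqNumCollars N) = Real.pi - eqPolarAngle N := by
  have : (eqNumCollars N : ℝ) ≠ 0 := by exact_mod_cast (eqNumCollars_bounds hN).1.ne'
  rw [idealAngle, idealHeight, mul_div_cancel₀ _ this]
  ring

lemma idealAngle_mem (hN : 40 ≤ N) {i : ℕ} (hi : i ≤ eqNumCollars N) :
    eqPolarAngle N ≤ idealAngle N i ∧ idealAngle N i ≤ Real.pi - eqPolarAngle N := by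
  obtain ⟨hk, hd, -⟩ := eqNumCollars_bounds hN
  have hs := (inv_sqrt_bounds hN).1
  have hd0 : 0 ≤ idealHeight N := by linarith
  have hiR : (i : ℝ) ≤ eqNumCollars N := by exact_mod_cast hi
  constructor
  · rw [idealAngle]
    have : 0 ≤ (i : ℝ) * idealHeight N := by positivity
    linarith
  · rw [← idealAngle_numCollars hN, idealAngle, idealAngle]
    gcongr

lemma abs_eqCapCount_sub_le (N i : ℕ) :
    |(eqCapCount N i : ℝ) - N * Real.sin (idealAngle N i / 2) ^ 2| ≤ 1 / 2 := by
  have h0 : 0 ≤ round ((N : ℝ) * Real.sin (idealAngle N i / 2) ^ 2) := by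
    rw [round_eq]
    exact Int.floor_nonneg.mpr (by positivity)
  have h1 : (eqCapCount N i : ℤ) = round ((N : ℝ) * Real.sin (idealAngle N i / 2) ^ 2) :=
    Int.toNat_of_nonneg h0
  have h2 : (eqCapCount N i : ℝ) =
      ((round ((N : ℝ) * Real.sin (idealAngle N i / 2) ^ 2) : ℤ) : ℝ) := by
    exact_mod_cast congrArg (Int.cast (R := ℝ)) h1
  rw [h2, abs_sub_comm]
  exact abs_sub_round _

lemma eqCapCount_le (N i : ℕ) : eqCapCount N i ≤ N := by
  have h1 := (abs_le.mp (abs_eqCapCount_sub_le N i)).2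
  have h2 : (N : ℝ) * Real.sin (idealAngle N i / 2) ^ 2 ≤ N :=
    mul_le_of_le_one_right (Nat.cast_nonneg _) (Real.sin_sq_le_one _)
  have : (eqCapCount N i : ℝ) < (N + 1 : ℕ) := by push_cast; linarith
  have : eqCapCount N i < N + 1 := by exact_mod_cast this
  omega

lemma eqCapAngle_mem (N i : ℕ) : 0 ≤ eqCapAngle N i ∧ eqCapAngle N i ≤ Real.pi := by
  rw [eqCapAngle]
  have h1 := Real.arcsin_nonneg.mpr (Real.sqrt_nonneg ((eqCapCount N i : ℝ) / N))
  have h2 := Real.arcsin_le_pi_div_two (√((eqCapCount N i : ℝ) / N))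
  constructor <;> linarith

lemma sin_half_eqCapAngle_sq (hN : 40 ≤ N) (i : ℕ) :
    N * Real.sin (eqCapAngle N i / 2) ^ 2 = eqCapCount N i := by
  have hNR : (0 : ℝ) < N := by exact_mod_cast (by omega : 0 < N)
  have h1 : (eqCapCount N i : ℝ) / N ≤ 1 := by
    rw [div_le_one hNR]; exact_mod_cast eqCapCount_le N i
  have h2 : √((eqCapCount N i : ℝ) / N) ≤ 1 := by
    rw [Real.sqrt_le_one]; exact h1
  rw [eqCapAngle, mul_div_cancel_left₀ _ two_ne_zero,
    Real.sin_arcsin (by linarith [Real.sqrt_nonneg ((eqCapCount N i : ℝ) / N)]) h2,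
    Real.sq_sqrt (by positivity)]
  field_simp

/-- Rounding moves the collar boundaries by a small fraction of the collar height. -/
lemma abs_eqCapAngle_sub_le (hN : 40 ≤ N) {i : ℕ} (hi : i ≤ eqNumCollars N) :
    |eqCapAngle N i - idealAngle N i| ≤ 0.7 * (1 / √(N : ℝ)) := by
  obtain ⟨h0, h1, h2, h3⟩ := inv_sqrt_bounds hN
  obtain ⟨ha, hb⟩ := eqPolarAngle_bounds hN
  obtain ⟨hc, hd⟩ := idealAngle_mem hN hi
  obtain ⟨ht0, htpi⟩ := eqCapAngle_mem N i
  have hS := sin_half_eqCapAngle_sq hN i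
  have hR := abs_le.mp (abs_eqCapCount_sub_le N i)
  rw [← hS] at hR
  set s := 1 / √(N : ℝ)
  set φ := idealAngle N i
  set τ := eqCapAngle N i
  have hNR : (0 : ℝ) < N := by exact_mod_cast (by omega : 0 < N)
  have hpi := Real.pi_gt_three
  have hA : 1.63 * s ≤ Real.sin (1.65 * s) := by
    have := mul_le_sin_of_sq_le (u := 1.65 * s) (b := 0.012) (by linarith) (by nlinarith)
    linarith
  have hB : 0.349 * s ≤ Real.sin (0.35 * s) := by
    have := mul_le_sin_of_sq_le (u := 0.35 * s) (b := 0.001) (by linarith) (by nlinarith)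
    linarith
  -- A shift by `0.7 s` from a boundary at least `2s` from the poles has midpoint at least `1.65 s`
  -- from them. It would change the cell count by at least `1.63 · 0.349 > 1/2`, more than rounding
  -- can.
  have hprod : ∀ u, 1.65 * s ≤ u → u ≤ Real.pi - 1.65 * s →
      1 / 2 < N * (Real.sin u * Real.sin (0.35 * s)) := by
    intro u hu1 hu2
    have h4 := hA.trans (sin_le_sin_of_mem (by linarith) hu1 hu2)
    have h5 := mul_le_mul h4 hB (by linarith) (by linarith)
    have h6 := mul_le_mul_of_nonneg_left h5 hNR.le
    have h7 : N * (1.63 * s * (0.349 * s)) = 1.63 * 0.349 := by linear_combination 1.63 * 0.349 * h1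
    rw [h7] at h6
    linarith
  by_contra hcon
  rcases lt_abs.mp (not_le.mp hcon) with h | h
  · have hle := (sin_sq_half_le_iff (u := φ + 0.7 * s) (v := τ) (by linarith) (by linarith)
      ht0 htpi).mpr (by linarith)
    have hdiff := sin_sq_half_sub (φ + 0.7 * s) φ
    rw [show (φ + 0.7 * s - φ) / 2 = 0.35 * s by ring] at hdiff
    have := hprod ((φ + 0.7 * s + φ) / 2) (by linarith) (by linarith)
    rw [← hdiff] at this
    nlinarith [mul_le_mul_of_nonneg_left hle hNR.le]
  · have hle := (sin_sq_half_le_iff (u := τ) (v := φ - 0.7 * s) ht0 htpi (by linarith)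
      (by linarith)).mpr (by linarith)
    have hdiff := sin_sq_half_sub φ (φ - 0.7 * s)
    rw [show (φ - (φ - 0.7 * s)) / 2 = 0.35 * s by ring] at hdiff
    have := hprod ((φ + (φ - 0.7 * s)) / 2) (by linarith) (by linarith)
    rw [← hdiff] at this
    nlinarith [mul_le_mul_of_nonneg_left hle hNR.le]

lemma eqCapAngle_succ_sub (hN : 40 ≤ N) {i : ℕ} (hi : i < eqNumCollars N) :
    1.69 * (1 / √(N : ℝ)) ≤ eqCapAngle N (i + 1) - eqCapAngle N i ∧
      eqCapAngle N (i + 1) - eqCapAngle N i ≤ 5.41 * (1 / √(N : ℝ)) := by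
  have h1 := abs_le.mp (abs_eqCapAngle_sub_le hN (i := i) hi.le)
  have h2 := abs_le.mp (abs_eqCapAngle_sub_le hN (i := i + 1) hi)
  obtain ⟨-, h3, h4⟩ := eqNumCollars_bounds hN
  have h5 : idealAngle N (i + 1) - idealAngle N i = idealHeight N := by
    simp only [idealAngle]; push_cast; ring
  constructor <;> linarith [h1.1, h1.2, h2.1, h2.2]

/-- No collar is empty, so the truncated subtraction in `eqCollarCount` is genuine. -/
lemma eqCapCount_lt_succ (hN : 40 ≤ N) {i : ℕ} (hi : i < eqNumCollars N) :
    eqCapCount N i < eqCapCount N (i + 1) := by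
  have h0 := (inv_sqrt_bounds hN).1
  have h1 := (eqCapAngle_succ_sub hN hi).1
  have hNR : (0 : ℝ) < N := by exact_mod_cast (by omega : 0 < N)
  obtain ⟨ha, hb⟩ := eqCapAngle_mem N i
  obtain ⟨ha', hb'⟩ := eqCapAngle_mem N (i + 1)
  have h2 := (sin_sq_half_le_iff ha' hb' ha hb).not.mpr (by linarith)
  have h3 := mul_lt_mul_of_pos_left (not_le.mp h2) hNR
  rw [sin_half_eqCapAngle_sq hN, sin_half_eqCapAngle_sq hN] at h3
  exact_mod_cast h3

lemma sum_eqCollarCount (hN : 40 ≤ N) {j : ℕ} (hj : j ≤ eqNumCollars N) :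
    ∑ i ∈ Finset.range j, eqCollarCount N i + eqCapCount N 0 = eqCapCount N j := by
  induction j with
  | zero => simp
  | succ j ih =>
    have h1 := ih (by omega)
    have h2 := eqCapCount_lt_succ hN (i := j) (by omega)
    rw [Finset.sum_range_succ, eqCollarCount]
    omega

/-- The collar counts telescope, and each polar cap accounts for at least one cell. An upper bound
is all the norming argument needs, so distinctness of the centers plays no role. -/
lemma card_zonalPoints_le (hN : 40 ≤ N) (φ : ℕ → ℝ) : (zonalPoints N φ).card ≤ N := by
  classical
  have h0 : 1 ≤ eqCapCount N 0 := by
    have h1 := (abs_le.mp (abs_eqCapCount_sub_le N 0)).1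
    have h2 := sin_half_eqPolarAngle_sq hN
    simp only [idealAngle, Nat.cast_zero, zero_mul, add_zero] at h1
    rw [h2] at h1
    have : (0 : ℝ) < eqCapCount N 0 := by linarith
    exact_mod_cast this
  have hk : eqCapCount N (eqNumCollars N) + 1 ≤ N := by
    have h1 := (abs_le.mp (abs_eqCapCount_sub_le N (eqNumCollars N))).2
    have h2 := sin_half_eqPolarAngle_sq hN
    have h3 := Real.sin_sq_add_cos_sq (eqPolarAngle N / 2)
    rw [idealAngle_numCollars hN, show (Real.pi - eqPolarAngle N) / 2 =
      Real.pi / 2 - eqPolarAngle N / 2 by ring, Real.sin_pi_div_two_sub] at h1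
    have h4 : (N : ℝ) * Real.cos (eqPolarAngle N / 2) ^ 2 = N - 1 := by
      linear_combination (N : ℝ) * h3 - h2
    have : (eqCapCount N (eqNumCollars N) : ℝ) < N := by linarith
    exact_mod_cast this
  have hsum := sum_eqCollarCount hN (le_refl (eqNumCollars N))
  rw [zonalPoints, if_neg (by omega), if_neg (by omega)]
  refine (Finset.card_union_le _ _).trans ?_
  have h1 : ({spherePoint 0 0, spherePoint Real.pi 0} : Finset S2).card ≤ 2 := Finset.card_le_two
  refine (Nat.add_le_add h1 (Finset.card_biUnion_le.trans (Finset.sum_le_sum fun i _ =>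
    Finset.card_image_le.trans (Finset.card_range _).le))).trans ?_
  omega

lemma exists_mem_collar {f : ℕ → ℝ} {k : ℕ} {a : ℝ} (h0 : f 0 ≤ a) (hk : a ≤ f k) (hk0 : 0 < k) :
    ∃ i < k, f i ≤ a ∧ a ≤ f (i + 1) := by
  induction k with
  | zero => omega
  | succ k ih =>
    rcases le_total (f k) a with h | h
    · exact ⟨k, by omega, h, hk⟩
    · rcases Nat.eq_zero_or_pos k with rfl | hk'
      · exact ⟨0, by omega, h0, hk⟩
      · obtain ⟨i, hi, h⟩ := ih h hk'
        exact ⟨i, by omega, h⟩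

/-- Every point of the sphere is close to the zonal equal area configuration. -/
lemma exists_zonalPoint_dist_le (hN : 40 ≤ N) (ψ : ℕ → ℝ) (x : S2) :
    ∃ y ∈ zonalPoints N ψ, dist x y ≤ 5 / √(N : ℝ) := by
  classical
  obtain ⟨a, l, ha0, hapi, rfl⟩ := exists_spherePoint_eq x
  obtain ⟨h0, h1, h2, h3⟩ := inv_sqrt_bounds hN
  obtain ⟨hpa, hpb⟩ := eqPolarAngle_bounds hN
  have hpi := Real.pi_gt_three
  rw [show 5 / √(N : ℝ) = 5 * (1 / √(N : ℝ)) by ring]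
  have hzp : zonalPoints N ψ = {spherePoint 0 0, spherePoint Real.pi 0} ∪
    (Finset.range (eqNumCollars N)).biUnion fun i =>
      (Finset.range (eqCollarCount N i)).image fun k : ℕ =>
        spherePoint ((eqCapAngle N i + eqCapAngle N (i + 1)) / 2)
          (ψ i + 2 * Real.pi * k / eqCollarCount N i) := by
    rw [zonalPoints, if_neg (by omega), if_neg (by omega)]
  rw [hzp]
  rcases le_total a (eqCapAngle N 0) with hnorth | hnorth
  · refine ⟨spherePoint 0 0, by simp, ?_⟩
    have e : spherePoint 0 0 = spherePoint 0 l := by simp [spherePoint]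
    have h4 := (abs_le.mp (abs_eqCapAngle_sub_le hN (Nat.zero_le _))).2
    simp only [idealAngle, Nat.cast_zero, zero_mul, add_zero] at h4
    rw [e]
    refine (dist_spherePoint_meridian_le _ _ _).trans ?_
    rw [sub_zero, abs_of_nonneg ha0]
    linarith
  rcases le_total (eqCapAngle N (eqNumCollars N)) a with hsouth | hsouth
  · refine ⟨spherePoint Real.pi 0, by simp, ?_⟩
    have e : spherePoint Real.pi 0 = spherePoint Real.pi l := by simp [spherePoint]
    have h4 := (abs_le.mp (abs_eqCapAngle_sub_le hN (le_refl (eqNumCollars N)))).1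
    rw [idealAngle_numCollars hN] at h4
    rw [e]
    refine (dist_spherePoint_meridian_le _ _ _).trans ?_
    rw [abs_of_nonpos (by linarith)]
    linarith
  obtain ⟨i, hi, hia, hib⟩ := exists_mem_collar hnorth hsouth (eqNumCollars_bounds hN).1
  obtain ⟨hD1, hD2⟩ := eqCapAngle_succ_sub hN hi
  have hcount := eqCapCount_lt_succ hN hi
  have hm : 0 < eqCollarCount N i := by rw [eqCollarCount]; omega
  obtain ⟨hi0, -⟩ := eqCapAngle_mem N i
  obtain ⟨-, hi1⟩ := eqCapAngle_mem N (i + 1)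
  set c := (eqCapAngle N i + eqCapAngle N (i + 1)) / 2 with hcdef
  set D := eqCapAngle N (i + 1) - eqCapAngle N i with hD
  have hsinc : 0 ≤ Real.sin c :=
    Real.sin_nonneg_of_nonneg_of_le_pi (by linarith) (by linarith)
  obtain ⟨k, hk, hdist⟩ := exists_sector c l (ψ i) hm hsinc
  refine ⟨spherePoint c (ψ i + 2 * Real.pi * k / eqCollarCount N i), ?_, ?_⟩
  · refine Finset.mem_union_right _ (Finset.mem_biUnion.mpr ⟨i, Finset.mem_range.mpr hi, ?_⟩)
    exact Finset.mem_image.mpr ⟨k, Finset.mem_range.mpr hk, rfl⟩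
  have hNR : (0 : ℝ) < N := by exact_mod_cast (by omega : 0 < N)
  have hmR : (0 : ℝ) < eqCollarCount N i := by exact_mod_cast hm
  -- Equal area: the count is proportional to `sin c`, which cancels in the width of a sector, so
  -- the estimate is uniform up to the poles.
  have hmeq : (eqCollarCount N i : ℝ) = N * (Real.sin c * Real.sin (D / 2)) := by
    have h4 := sin_sq_half_sub (eqCapAngle N (i + 1)) (eqCapAngle N i)
    rw [add_comm (eqCapAngle N (i + 1))] at h4
    rw [← h4, mul_sub, sin_half_eqCapAngle_sq hN, sin_half_eqCapAngle_sq hN, eqCollarCount,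
      Nat.cast_sub hcount.le]
  set s := 1 / √(N : ℝ)
  have hsin : 0.484 * D ≤ Real.sin (D / 2) := by
    have h4 : (D / 2) ^ 2 ≤ 6 * 0.032 := by nlinarith
    have := mul_le_sin_of_sq_le (u := D / 2) (b := 0.032) (by linarith) h4
    linarith
  have hDpos : 0 < D := by linarith
  have hpar : Real.sin c * (Real.pi / eqCollarCount N i) ≤ 6.51 * s ^ 2 / D := by
    rw [mul_div_assoc', div_le_div_iff₀ hmR hDpos]
    have h5 : D * Real.pi ≤ 6.51 * Real.sin (D / 2) := by
      nlinarith [Real.pi_lt_d2]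
    calc Real.sin c * Real.pi * D = Real.sin c * (D * Real.pi) := by ring
      _ ≤ Real.sin c * (6.51 * Real.sin (D / 2)) := mul_le_mul_of_nonneg_left h5 hsinc
      _ = 6.51 * s ^ 2 * (eqCollarCount N i) := by
        rw [hmeq]; linear_combination (-6.51 * Real.sin c * Real.sin (D / 2)) * h1
  have hmer : |a - c| ≤ D / 2 := by
    rw [abs_le]; constructor <;> linarith
  have htri := dist_triangle (spherePoint a l) (spherePoint c l)
    (spherePoint c (ψ i + 2 * Real.pi * k / eqCollarCount N i))
  have hmd := dist_spherePoint_meridian_le a c l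
  -- `D/2 + 6.51 s²/D` is convex in `D`, and below `5s` at both ends of `[1.69 s, 5.41 s]`.
  have hfin : 6.51 * s ^ 2 / D ≤ 5 * s - D / 2 := by
    rw [div_le_iff₀ hDpos]
    nlinarith [mul_nonneg (sub_nonneg.mpr hD1) (sub_nonneg.mpr hD2)]
  linarith

end Zonal

/-! ### The constants for zonal configurations -/

lemma zonal_constant_isEquivalent :
    (fun n : ℕ => 14 * (n : ℝ) / (1 - (4 * Real.pi * n)⁻¹)) ~[atTop]
      (fun n : ℕ => 14 * (n : ℝ)) := by
  have h1 : Tendsto (fun n : ℕ => 14 / (1 - (4 * Real.pi)⁻¹ / (n : ℝ))) atTop (nhds 14) := by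
    have h2 := (tendsto_const_div_natCast (4 * Real.pi)⁻¹).const_sub 1
    have h3 := (tendsto_const_nhds (x := (14 : ℝ))).div h2 (by norm_num)
    rw [sub_zero, div_one] at h3
    exact h3
  have h2 := (isEquivalent_const_iff_tendsto (by norm_num)).mpr h1
  have h3 := h2.mul (IsEquivalent.refl (u := fun n : ℕ => (n : ℝ)))
  refine h3.congr_left (Eventually.of_forall fun n => ?_)
  simp only [Pi.mul_apply]
  rw [mul_inv, ← div_eq_mul_inv]
  ring

/-- With `q = 1/(4πn)`, both choices of `M` lie between `(7n(1-q))²` and `(7n/(1-q))² + 1`, and only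
these bounds are used. They give `M ≥ 40` already for `n = 1`. -/
theorem zonal_norming {n : ℕ} (hn : 1 ≤ n) {M : ℕ} (ψ : ℕ → ℝ)
    (hM : M = ⌈49 * ((n : ℝ) - 1 / (4 * Real.pi)) ^ 2⌉₊ ∨ M = meshSize (7 / 2) (1 / 2) n) :
    ∃ c > 0, (∀ p ∈ polySpace n S2, ∃ y ∈ zonalPoints M ψ, c * ‖p‖ ≤ |p y|) ∧
      0 ≤ 14 * (n : ℝ) / (1 - (4 * Real.pi * n)⁻¹) ∧
      ((zonalPoints M ψ).card : ℝ) ≤ (c * (14 * n / (1 - (4 * Real.pi * n)⁻¹))) ^ 2 := by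
  have hpi := Real.pi_gt_d2
  have hn' : (1 : ℝ) ≤ n := by exact_mod_cast hn
  set q := (4 * Real.pi * n)⁻¹ with hq
  have hq0 : 0 < q := by positivity
  have hq1 : q ≤ 0.08 := by
    rw [hq]
    exact inv_le_of_inv_le₀ (by norm_num) (by nlinarith)
  have hnq : (n : ℝ) - 1 / (4 * Real.pi) = n * (1 - q) := by
    rw [hq]; field_simp
  have hr0 : 0 < 1 - q := by linarith
  have hsigma : sigma (7 / 2) (1 / 2) n * n = 7 * n / (1 - q) := by
    have h1 : 2 * Real.pi - 1 / 2 / n = 2 * Real.pi * (1 - q) := by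
      rw [hq]; field_simp; ring
    rw [sigma, h1]
    field_simp
  have hX : n * (1 - q) ≤ n / (1 - q) := by
    rw [le_div_iff₀ hr0]
    have : (1 - q) * (1 - q) ≤ 1 := by nlinarith
    nlinarith
  have hX1 : n ≤ n / (1 - q) := by
    rw [le_div_iff₀ hr0]
    nlinarith
  have hX0 : 0.92 ≤ n * (1 - q) := by nlinarith
  have hlow : (7 * (n * (1 - q))) ^ 2 ≤ (M : ℝ) := by
    rcases hM with rfl | rfl
    · refine le_trans (le_of_eq ?_) (Nat.le_ceil _)
      rw [hnq]; ring
    · rw [meshSize, ← mul_pow, hsigma]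
      refine le_trans ?_ (Nat.le_ceil _)
      rw [mul_div_assoc]
      gcongr
  have hup : (M : ℝ) ≤ (7 * (n / (1 - q))) ^ 2 + 1 := by
    rcases hM with rfl | rfl
    · refine (Nat.ceil_lt_add_one (by positivity)).le.trans ?_
      rw [hnq, show 49 * (n * (1 - q)) ^ 2 = (7 * (n * (1 - q))) ^ 2 by ring]
      gcongr
    · rw [meshSize, ← mul_pow, hsigma]
      refine (Nat.ceil_lt_add_one (by positivity)).le.trans ?_
      rw [mul_div_assoc]
  have hM40 : 40 ≤ M := by
    have : (40 : ℝ) ≤ M := by nlinarith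
    exact_mod_cast this
  -- The angle `0.95/n` is wide enough for the radius `5/√M`, since `0.95 (1 - 1.9q) · 7(1 - q) ≥ 5`
  -- for `q ≤ 0.08`. It still leaves `14c > 7.6`, so `(14c)² ≥ 49 + 1` absorbs the ceiling.
  refine ⟨1 - 0.95 ^ 2 / 2, by norm_num, fun p hp => norming_of_covering hn (by norm_num)
    (by norm_num) (fun x => ?_) hp, by positivity, ?_⟩
  · obtain ⟨y, hy, hd⟩ := exists_zonalPoint_dist_le hM40 ψ x
    refine ⟨y, hy, hd.trans ?_⟩
    have h1 : 7 * (n * (1 - q)) ≤ √(M : ℝ) := Real.le_sqrt_of_sq_le hlow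
    have h2 : (0.95 : ℝ) / n / (2 * Real.pi) = 1.9 * q := by
      rw [hq]; field_simp; norm_num
    rw [h2]
    calc 5 / √(M : ℝ) ≤ 5 / (7 * (n * (1 - q))) := by gcongr
      _ ≤ _ := by
        rw [div_mul_eq_mul_div, div_le_div_iff₀ (by positivity) (by linarith)]
        have h3 : 5 ≤ 0.95 * (1 - 1.9 * q) * (7 * (1 - q)) := by nlinarith
        nlinarith [mul_le_mul_of_nonneg_right h3 (show (0 : ℝ) ≤ n by linarith)]
  · have h1 : ((zonalPoints M ψ).card : ℝ) ≤ M := by exact_mod_cast card_zonalPoints_le hM40 ψ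
    refine h1.trans (hup.trans ?_)
    rw [mul_div_assoc]
    nlinarith

theorem corollary2 :
    -- dimension of the polynomial space of degree `2n` on the sphere
    (∀ n : ℕ, Module.finrank ℝ (polySpace (2 * n) S2) = (2 * n + 1) ^ 2) ∧
    -- good covering meshes
    (∀ (X : ℕ → Finset S2) (α θ : ℝ), 0 < α → IsGoodCovering X α → 0 < θ → θ < 1 →
      (∀ n : ℕ, 1 ≤ n → ∃ (T : Finset S2) (w : S2 → ℝ),
        IsCatch (2 * n) (X (meshSize α θ n)) T w) ∧
      (∀ (T : ℕ → Finset S2) (w : ℕ → S2 → ℝ),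
        (∀ n : ℕ, 1 ≤ n → IsCatch (2 * n) (X (meshSize α θ n)) (T n) (w n)) →
          IsWeaklyAdmissibleMesh S2 T (fun n => sigma α θ n * n / (1 - θ)) ∧
          ∀ n : ℕ, 1 ≤ n → (T n).card ≤ (2 * n + 1) ^ 2 ∧
            ∀ f : C(S2, ℝ), (∃! q, IsWeightedLS n (T n) (w n) f q) ∧
              ∀ q, IsWeightedLS n (T n) (w n) f q →
                ‖f - q‖ ≤ (1 + sigma α θ n * n / (1 - θ)) * bestError n f) ∧
      (fun n : ℕ => sigma α θ n * n / (1 - θ)) ~[atTop]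
        (fun n : ℕ => α * n / (θ * (1 - θ)))) ∧
    -- zonal equal area configurations
    (∀ (φ : ℕ → ℕ → ℝ) (M : ℕ → ℕ),
      ((∀ n, M n = ⌈49 * ((n : ℝ) - 1 / (4 * Real.pi)) ^ 2⌉₊) ∨
        (∀ n, M n = meshSize (7 / 2) (1 / 2) n)) →
      (∀ n : ℕ, 1 ≤ n → ∃ (T : Finset S2) (w : S2 → ℝ),
        IsCatch (2 * n) (zonalPoints (M n) (φ (M n))) T w) ∧
      (∀ (T : ℕ → Finset S2) (w : ℕ → S2 → ℝ),
        (∀ n : ℕ, 1 ≤ n →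
          IsCatch (2 * n) (zonalPoints (M n) (φ (M n))) (T n) (w n)) →
          IsWeaklyAdmissibleMesh S2 T
            (fun n => 14 * n / (1 - (4 * Real.pi * n)⁻¹)) ∧
          ∀ n : ℕ, 1 ≤ n → (T n).card ≤ (2 * n + 1) ^ 2 ∧
            ∀ f : C(S2, ℝ), (∃! q, IsWeightedLS n (T n) (w n) f q) ∧
              ∀ q, IsWeightedLS n (T n) (w n) f q →
                ‖f - q‖ ≤ (1 + 14 * n / (1 - (4 * Real.pi * n)⁻¹)) * bestError n f)) ∧
    (fun n : ℕ => 14 * (n : ℝ) / (1 - (4 * Real.pi * n)⁻¹)) ~[atTop]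
      (fun n : ℕ => 14 * (n : ℝ)) := by

  refine ⟨fun n => finrank_polySpace_S2 (2 * n), fun X α θ hα hX hθ0 hθ1 => ?_, fun φ M hM => ?_,
    zonal_constant_isEquivalent⟩
  · have heq := sigma_isEquivalent (θ := θ) hα hθ0
    have hO : (fun n : ℕ => sigma α θ n * n / (1 - θ)) =O[atTop] fun n : ℕ => (n : ℝ) := by
      refine heq.isBigO.trans ?_
      refine (isBigO_const_mul_self (α / (θ * (1 - θ))) (fun n : ℕ => (n : ℝ)) atTop).congr_left
        fun n => ?_
      ring
    obtain ⟨h1, h2⟩ := catch_mesh_properties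
      (fun n hn => goodCovering_norming hX hθ0 hθ1 hn) hO
    exact ⟨h1, h2, heq⟩
  · refine catch_mesh_properties (A := fun n => zonalPoints (M n) (φ (M n)))
      (fun n hn => zonal_norming hn _ ?_)
      (zonal_constant_isEquivalent.isBigO.trans (isBigO_const_mul_self _ _ _))
    exact hM.imp (fun h => h n) fun h => h n
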